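/- Let $r\ge 2$ be a fixed integer. An instance of Max $r$-Lin AA is a system of $m$ linear equations over $\mathbb{F}_2$ in $n$ variables $z_1,\dots,z_n$ (equations may be repeated), in which every equation $\sum_{i\in S}z_i=b$ satisfies $1\le |S|\le r$ and carries a positive integral weight, together with a parameter $k\in\mathbb{N}$; the equations are given by listing, for each of them, the indices in $S$, the right-hand side $b$ and the weight. The excess of an assignment $z\in\mathbb{F}_2^n$ is the total weight of satisfied equations minus the total weight of falsified equations, and the question is whether the maximum excess over all assignments is at least $k$. (1) Max $r$-Lin AA has a kernel with $O(k\log k)$ variables: there are functions $f,g,h:\mathbb{N}\to\mathbb{N}$ with $h(k)=O(k\log k)$ as $k\to\infty$ and an algorithm, running in time polynomial in the bit length of the input, that maps every instance $(x,k)$ of Max $r$-Lin AA to an instance $(x',k')$ of Max $r$-Lin AA such that $(x,k)$ is a yes-instance if and only if $(x',k')$ is one, $k'\le f(k)$, the bit length of $x'$ is at most $g(k)$, and $x'$ has at most $h(k)$ variables. (2) Max $r$-Lin AA can be solved in time $2^{O(k\log k)}+m^{O(1)}$: there are a function $h(k)=O(k\log k)$, a constant $d$ and an algorithm that decides every instance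 in time at most $2^{h(k)}+m^{d}$. The constants and functions depend only on $r$. Time is the number of operations of a random access machine with uniform cost, whose arithmetic operations are addition and truncated subtraction of natural numbers. -/

import Mathlib

/-! ### Random access machine with uniform cost

Programs are structured RAM programs. The memory consists of banks of cells that hold natural
numbers; a cell is addressed by a bank (fixed in the program text, so that a program uses finitely
many banks) and a computed address. The arithmetic operations are addition and truncated
subtraction; there is no multiplication, so that a run of `t` steps creates only numbers with
`O(t)` more bits than the input, and polynomial time is the same as for Turing machines. -/

/-- Memory: bank, then address. -/
abbrev RAMState : Type := ℕ → ℕ → ℕ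

/-- Expressions. -/
inductive RAMExpr : Type
  | const (c : ℕ) : RAMExpr
  | get (bank : ℕ) (addr : RAMExpr) : RAMExpr
  | add (e₁ e₂ : RAMExpr) : RAMExpr
  | sub (e₁ e₂ : RAMExpr) : RAMExpr

/-- Value of an expression. -/
def RAMExpr.eval (s : RAMState) : RAMExpr → ℕ
  | const c => c
  | get b a => s b (a.eval s)
  | add e₁ e₂ => e₁.eval s + e₂.eval s
  | sub e₁ e₂ => e₁.eval s - e₂.eval s

/-- Number of operations needed to evaluate an expression. -/
def RAMExpr.cost : RAMExpr → ℕ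
  | const _ => 1
  | get _ a => a.cost + 1
  | add e₁ e₂ => e₁.cost + e₂.cost + 1
  | sub e₁ e₂ => e₁.cost + e₂.cost + 1

/-- Programs. -/
inductive RAMProg : Type
  | skip : RAMProg
  | assign (bank : ℕ) (addr val : RAMExpr) : RAMProg
  | seq (P Q : RAMProg) : RAMProg
  | cond (e : RAMExpr) (P Q : RAMProg) : RAMProg
  | loop (e : RAMExpr) (P : RAMProg) : RAMProg

/-- Writing the value `v` to address `a` of bank `b`. -/
def RAMState.write (s : RAMState) (b a v : ℕ) : RAMState :=
  Function.update s b (Function.update (s b) a v)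

/-- `RAMExec P s t s'`: started in `s`, the program `P` halts in `s'` after exactly `t` operations.
`cond e P Q` runs `P` if `e ≠ 0` and `Q` otherwise; `loop e P` repeats `P` while `e ≠ 0`. -/
inductive RAMExec : RAMProg → RAMState → ℕ → RAMState → Prop
  | skip (s : RAMState) : RAMExec .skip s 1 s
  | assign (b : ℕ) (a e : RAMExpr) (s : RAMState) :
      RAMExec (.assign b a e) s (a.cost + e.cost + 1) (s.write b (a.eval s) (e.eval s))
  | seq {P Q : RAMProg} {s s' s'' : RAMState} {t t' : ℕ} :
      RAMExec P s t s' → RAMExec Q s' t' s'' → RAMExec (.seq P Q) s (t + t') s''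
  | cond_true {e : RAMExpr} {P Q : RAMProg} {s s' : RAMState} {t : ℕ} :
      e.eval s ≠ 0 → RAMExec P s t s' → RAMExec (.cond e P Q) s (e.cost + 1 + t) s'
  | cond_false {e : RAMExpr} {P Q : RAMProg} {s s' : RAMState} {t : ℕ} :
      e.eval s = 0 → RAMExec Q s t s' → RAMExec (.cond e P Q) s (e.cost + 1 + t) s'
  | loop_done {e : RAMExpr} {P : RAMProg} {s : RAMState} :
      e.eval s = 0 → RAMExec (.loop e P) s (e.cost + 1) s
  | loop_step {e : RAMExpr} {P : RAMProg} {s s' s'' : RAMState} {t t' : ℕ} :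
      e.eval s ≠ 0 → RAMExec P s t s' → RAMExec (.loop e P) s' t' s'' →
        RAMExec (.loop e P) s (e.cost + 1 + t + t') s''

/-- Runs are deterministic: the running time and the final memory are determined. -/
theorem RAMExec.deterministic {P : RAMProg} {s s₁ s₂ : RAMState} {t₁ t₂ : ℕ}
    (h₁ : RAMExec P s t₁ s₁) (h₂ : RAMExec P s t₂ s₂) : t₁ = t₂ ∧ s₁ = s₂ := by
  induction h₁ generalizing t₂ s₂ with
  | skip s => cases h₂; exact ⟨rfl, rfl⟩
  | assign b a e s => cases h₂; exact ⟨rfl, rfl⟩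
  | seq _ _ ih ih' =>
    cases h₂ with
    | seq h h' =>
      obtain ⟨rfl, rfl⟩ := ih h
      obtain ⟨rfl, rfl⟩ := ih' h'
      exact ⟨rfl, rfl⟩
  | cond_true he _ ih =>
    cases h₂ with
    | cond_true _ h => obtain ⟨rfl, rfl⟩ := ih h; exact ⟨rfl, rfl⟩
    | cond_false he' _ => exact absurd he' he
  | cond_false he _ ih =>
    cases h₂ with
    | cond_true he' _ => exact absurd he he'
    | cond_false _ h => obtain ⟨rfl, rfl⟩ := ih h; exact ⟨rfl, rfl⟩
  | loop_done he =>
    cases h₂ with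
    | loop_done _ => exact ⟨rfl, rfl⟩
    | loop_step he' _ _ => exact absurd he he'
  | loop_step he _ _ ih ih' =>
    cases h₂ with
    | loop_done he' => exact absurd he' he
    | loop_step _ h h' =>
      obtain ⟨rfl, rfl⟩ := ih h
      obtain ⟨rfl, rfl⟩ := ih' h'
      exact ⟨rfl, rfl⟩

/-- Initial memory: bank `0` holds the length of the input followed by the input; all other cells
are `0`. -/
def RAMState.init (l : List ℕ) : RAMState := fun b a =>
  if b = 0 then (l.length :: l).getD a 0 else 0

/-- Bank `1` holds the length of the list `l` followed by `l`. -/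
def RAMState.HasOutput (s : RAMState) (l : List ℕ) : Prop :=
  ∀ (i : ℕ) (h : i < (l.length :: l).length), s 1 i = (l.length :: l)[i]

/-- On the given input, the program halts with the given output after at most `T` operations. -/
def RAMProg.OutputsInTime (P : RAMProg) (input output : List ℕ) (T : ℕ) : Prop :=
  ∃ (t : ℕ) (s : RAMState), t ≤ T ∧ RAMExec P (RAMState.init input) t s ∧ s.HasOutput output

/-! ### Parameterized problems and kernels -/

/-- Number of bits of a list of natural numbers written in binary, with one separator for each. -/
def bitLength (l : List ℕ) : ℕ := (l.map fun a => Nat.size a + 1).sum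

/-- A parameterized problem: instances, their encoding, and the pairs `(x, k)` with answer yes. -/
structure ParamProblem where
  Instance : Type
  encode : Instance → List ℕ
  Yes : Instance → ℕ → Prop

/-- The problem has a kernel in which the quantity `ν` is at most `h k`: there is a polynomial-time
algorithm that maps each `(x, k)` to an equivalent `(x', k')` with `k' ≤ f k`, `|x'| ≤ g k` and
`ν x' ≤ h k`. -/
def ParamProblem.HasKernelWith (L : ParamProblem) (ν : L.Instance → ℕ) (h : ℕ → ℕ) : Prop :=
  ∃ (P : RAMProg) (p : Polynomial ℕ) (f g : ℕ → ℕ), ∀ (x : L.Instance) (k : ℕ),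
    ∃ (x' : L.Instance) (k' : ℕ),
      P.OutputsInTime (k :: L.encode x) (k' :: L.encode x')
        (p.eval (bitLength (k :: L.encode x))) ∧
      (L.Yes x k ↔ L.Yes x' k') ∧ k' ≤ f k ∧ bitLength (L.encode x') ≤ g k ∧ ν x' ≤ h k

/-- Some program decides every `(x, k)` in at most `T x k` operations, answering `1` or `0`. -/
def ParamProblem.SolvableInTime (L : ParamProblem) (T : L.Instance → ℕ → ℕ) : Prop :=
  ∃ P : RAMProg, ∀ (x : L.Instance) (k : ℕ),
    (L.Yes x k → P.OutputsInTime (k :: L.encode x) [1] (T x k)) ∧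
    (¬ L.Yes x k → P.OutputsInTime (k :: L.encode x) [0] (T x k))

/-! ### Max r-Lin above average -/

/-- A weighted equation `∑ i ∈ S, z i = b` over `𝔽₂` in the variables `z 0, …, z (n - 1)`, with
at least one and at most `r` variables and a positive integral weight. -/
structure WeightedEq (r n : ℕ) where
  S : Finset (Fin n)
  b : ZMod 2
  w : ℕ
  nonempty : S.Nonempty
  card_le : S.card ≤ r
  w_pos : 0 < w

/-- The assignment `z` satisfies the equation. -/
def WeightedEq.Sat {r n : ℕ} (e : WeightedEq r n) (z : Fin n → ZMod 2) : Prop :=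
  ∑ i ∈ e.S, z i = e.b

instance {r n : ℕ} (e : WeightedEq r n) (z : Fin n → ZMod 2) : Decidable (e.Sat z) :=
  inferInstanceAs (Decidable (_ = _))

/-- A system of weighted equations (possibly with repetitions) in `n` variables, each equation
having at most `r` variables. -/
structure RLinSystem (r : ℕ) where
  n : ℕ
  eqs : List (WeightedEq r n)

namespace RLinSystem

/-- Number of equations. -/
def m {r : ℕ} (I : RLinSystem r) : ℕ := I.eqs.length

/-- Total weight of satisfied equations minus total weight of falsified equations. -/
def excess {r : ℕ} (I : RLinSystem r) (z : Fin I.n → ZMod 2) : ℤ :=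
  ((I.eqs.filter fun e => e.Sat z).map fun e => (e.w : ℤ)).sum -
    ((I.eqs.filter fun e => ¬ e.Sat z).map fun e => (e.w : ℤ)).sum

/-- Maximum excess over all assignments. -/
def maxExcess {r : ℕ} (I : RLinSystem r) : ℤ :=
  (Finset.univ : Finset (Fin I.n → ZMod 2)).sup' ⟨0, Finset.mem_univ 0⟩ I.excess

/-- Encoding: `n`, `m`, and for every equation the number of its variables, the increasing list
of the indices of its variables, its right-hand side and its weight. -/
def encode {r : ℕ} (I : RLinSystem r) : List ℕ :=
  I.n :: I.m :: I.eqs.flatMap fun e =>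
    e.S.card :: ((e.S.sort (· ≤ ·)).map fun i => (i : ℕ)) ++ [e.b.val, e.w]

end RLinSystem

/-- Max r-Lin AA: is the maximum excess at least the parameter `k`? -/
def maxRLinAA (r : ℕ) : ParamProblem where
  Instance := RLinSystem r
  encode := RLinSystem.encode
  Yes I k := (k : ℤ) ≤ I.maxExcess

/-! ### Verified execution of RAM programs with automatic time bounds -/

/-! Write the excess of an assignment as an integral combination f(z) = ∑ c(u) χ_u(z) of characters
of 𝔽₂ⁿ, where c(u) is the total signed weight of the equations with variable set u. Since no
equation is empty, c(0) = 0. Sets with c(u) = 0 can be dropped; the variables of the remaining ones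
are called essential.

The core is a lower bound for max f by a Riesz product (`exists_le_of_sumFree`). For a set K of
vectors and signs ε(u) of c(u), the function ∏_{u ∈ K} (1 + ε(u) χ_u) is nonnegative with mean 1. If
no nonempty subset of K sums to 0 and no subset of size at least 2 sums into the support of c, the
mean of f against it is exactly ∑_{u ∈ K} |c(u)|, so f attains this value. Such a K is found in
`exists_le_of_cover`. A random subset sum of the support is nonzero in half of the essential
coordinates on average, so 2rk essential variables give a sum w of Hamming weight at least rk. A
smallest subset K of the support with sum w has at least k elements, because each covers at most r
coordinates, and minimality gives both conditions on subset sums. As c is integral, max f ≥ |K| ≥ k.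

Hence the answer is yes if there are at least 2rk essential variables, or if some |c(u)| ≥ k.
Otherwise merging equations with equal variable sets and renaming variables leaves fewer than 2rk
variables, at most 2^(2rk) equations and weights below k. This is a kernel, even with O(k)
variables. Exhaustive search over the essential variables decides the problem; its polynomial time
bound in m and 2^(2rk) is split into a sum by `mul_pow_le_two_pow_add_pow`.

The rest verifies RAM programs. A run is certified by a postcondition together with one bound B for
the iterations of every loop; the resulting time is polynomial in B by `exists_timeBound_le`. Time
is thus never counted along a run. -/

namespace RAMState

@[simp] theorem write_ne (s : RAMState) {b b' : ℕ} (a v : ℕ) (h : b' ≠ b) :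
    s.write b a v b' = s b' := by
  simp [write, Function.update_of_ne h]

@[simp] theorem write_self (s : RAMState) (b a v : ℕ) :
    s.write b a v b = Function.update (s b) a v := by
  simp [write]

end RAMState

namespace RAMProg

/-- Whether the program contains an assignment to a cell of the given bank. -/
def writes : RAMProg → ℕ → Bool
  | skip, _ => false
  | assign b _ _, c => b == c
  | seq P Q, c => P.writes c || Q.writes c
  | cond _ P Q, c => P.writes c || Q.writes c
  | loop _ P, c => P.writes c

/-- Bound for the running time if every loop is iterated at most `B` times whenever it is run. -/
def timeBound (B : ℕ) : RAMProg → ℕ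
  | skip => 1
  | assign _ a e => a.cost + e.cost + 1
  | seq P Q => P.timeBound B + Q.timeBound B
  | cond e P Q => e.cost + 1 + (P.timeBound B + Q.timeBound B)
  | loop e P => B * (e.cost + 1 + P.timeBound B) + (e.cost + 1)

/-- The time bound is polynomial in the bound for the numbers of iterations. -/
theorem exists_timeBound_le (P : RAMProg) :
    ∃ C D : ℕ, ∀ B, P.timeBound B ≤ C * (B + 1) ^ D := by
  have one (B D : ℕ) : 1 ≤ (B + 1) ^ D := Nat.one_le_pow _ _ (Nat.succ_pos B)
  have of_add {f g : ℕ → ℕ} (hf : ∃ C D : ℕ, ∀ B, f B ≤ C * (B + 1) ^ D)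
      (hg : ∃ C D : ℕ, ∀ B, g B ≤ C * (B + 1) ^ D) :
      ∃ C D : ℕ, ∀ B, f B + g B ≤ C * (B + 1) ^ D := by
    obtain ⟨C, D, h⟩ := hf
    obtain ⟨C', D', h'⟩ := hg
    refine ⟨C + C', D + D', fun B => ?_⟩
    calc f B + g B ≤ C * (B + 1) ^ D + C' * (B + 1) ^ D' := add_le_add (h B) (h' B)
      _ ≤ C * (B + 1) ^ (D + D') + C' * (B + 1) ^ (D + D') := by
        gcongr <;> omega
      _ = _ := by ring
  have cst (c : ℕ) : ∃ C D : ℕ, ∀ B, (fun _ : ℕ => c) B ≤ C * (B + 1) ^ D := ⟨c, 0, by simp⟩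
  induction P with
  | skip => exact cst 1
  | assign b a e => exact cst _
  | seq P Q hP hQ => exact of_add hP hQ
  | cond e P Q hP hQ => exact of_add (cst _) (of_add hP hQ)
  | loop e P hP =>
    refine of_add ?_ (cst _)
    obtain ⟨C, D, h⟩ := of_add (cst (e.cost + 1)) hP
    refine ⟨C, D + 1, fun B => ?_⟩
    calc B * (e.cost + 1 + P.timeBound B) ≤ (B + 1) * (C * (B + 1) ^ D) :=
          Nat.mul_le_mul (Nat.le_succ B) (h B)
      _ = _ := by ring

end RAMProg

/-- Banks to which a program does not write are unchanged. -/
theorem RAMExec.frame {P : RAMProg} {s s' : RAMState} {t : ℕ} (h : RAMExec P s t s') {b : ℕ}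
    (hb : P.writes b = false) : s' b = s b := by
  induction h with
  | skip => rfl
  | assign c a e s =>
    refine RAMState.write_ne _ _ _ fun hcb => ?_
    simp [RAMProg.writes, hcb] at hb
  | seq _ _ ih ih' =>
    simp only [RAMProg.writes, Bool.or_eq_false_iff] at hb
    rw [ih' hb.2, ih hb.1]
  | cond_true _ _ ih =>
    simp only [RAMProg.writes, Bool.or_eq_false_iff] at hb
    exact ih hb.1
  | cond_false _ _ ih =>
    simp only [RAMProg.writes, Bool.or_eq_false_iff] at hb
    exact ih hb.2
  | loop_done _ => rfl
  | loop_step _ _ _ ih ih' => rw [ih' hb, ih hb]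

/-- The program halts within its time bound in a state that satisfies `Q`. -/
def Runs (B : ℕ) (P : RAMProg) (s : RAMState) (Q : RAMState → Prop) : Prop :=
  ∃ (t : ℕ) (s₁ : RAMState), t ≤ P.timeBound B ∧ RAMExec P s t s₁ ∧ Q s₁

/-- The states agree outside the banks to which the program writes. -/
def Frame (P : RAMProg) (s s' : RAMState) : Prop := ∀ b, P.writes b = false → s' b = s b

namespace Runs

variable {B : ℕ} {P P' : RAMProg} {s : RAMState} {Q R : RAMState → Prop}

/-- The frame condition comes for free here, so postconditions only describe banks that are written;
all others are recovered afterwards from the program text, usually by `rfl`. -/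
theorem mono (h : Runs B P s Q) (hQR : ∀ s', Frame P s s' → Q s' → R s') : Runs B P s R := by
  obtain ⟨t, s', ht, he, hq⟩ := h
  exact ⟨t, s', ht, he, hQR s' (fun b hb => he.frame hb) hq⟩

theorem skip (h : Q s) : Runs B .skip s Q := ⟨1, s, le_rfl, .skip s, h⟩

theorem assign {b : ℕ} {a e : RAMExpr} (h : Q (s.write b (a.eval s) (e.eval s))) :
    Runs B (.assign b a e) s Q := ⟨_, _, le_rfl, .assign b a e s, h⟩

theorem seq (h : Runs B P s fun s' => Runs B P' s' Q) : Runs B (.seq P P') s Q := by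
  obtain ⟨t, s', ht, he, t', s'', ht', he', hq⟩ := h
  exact ⟨t + t', s'', add_le_add ht ht', .seq he he', hq⟩

theorem cond {e : RAMExpr} (h₁ : e.eval s ≠ 0 → Runs B P s Q) (h₀ : e.eval s = 0 → Runs B P' s Q) :
    Runs B (.cond e P P') s Q := by
  by_cases h : e.eval s = 0
  · obtain ⟨t, s', ht, he, hq⟩ := h₀ h
    exact ⟨_, s', by simp only [RAMProg.timeBound]; omega, .cond_false h he, hq⟩
  · obtain ⟨t, s', ht, he, hq⟩ := h₁ h
    exact ⟨_, s', by simp only [RAMProg.timeBound]; omega, .cond_true h he, hq⟩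

/-- The invariant is indexed by the number of completed rounds and determines when the loop stops,
so there are exactly `n` rounds; the induction is on the rounds that remain. -/
theorem loop {e : RAMExpr} {n : ℕ} (hn : n ≤ B) (I : ℕ → RAMState → Prop) (h₀ : I 0 s)
    (hstep : ∀ j s, j < n → I j s → e.eval s ≠ 0 ∧ Runs B P s (I (j + 1)))
    (hend : ∀ s, I n s → e.eval s = 0 ∧ Q s) : Runs B (.loop e P) s Q := by
  have key : ∀ d j s, j + d = n → I j s → ∃ (t : ℕ) (s' : RAMState),
      t ≤ d * (e.cost + 1 + P.timeBound B) + (e.cost + 1) ∧ RAMExec (.loop e P) s t s' ∧ Q s' := by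
    intro d
    induction d with
    | zero =>
      rintro j s rfl hI
      obtain ⟨he, hq⟩ := hend s hI
      exact ⟨_, s, by simp, .loop_done he, hq⟩
    | succ d ih =>
      intro j s hj hI
      obtain ⟨he, t, s', ht, hex, hI'⟩ := hstep j s (by omega) hI
      obtain ⟨t', s'', ht', hex', hq⟩ := ih (j + 1) s' (by omega) hI'
      refine ⟨_, s'', ?_, .loop_step he hex hex', hq⟩
      rw [Nat.succ_mul]
      omega
  obtain ⟨t, s', ht, he, hq⟩ := key n 0 s (by omega) h₀
  refine ⟨t, s', ht.trans ?_, he, hq⟩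
  simp only [RAMProg.timeBound]
  gcongr

end Runs

/-- The register stored at address `0` of a bank. -/
abbrev RAMExpr.reg (b : ℕ) : RAMExpr := .get b (.const 0)

/-- Assignment to a register. -/
abbrev RAMProg.setReg (b : ℕ) (e : RAMExpr) : RAMProg := .assign b (.const 0) e

/-- Sequential composition. -/
infixr:50 ";;" => RAMProg.seq

open RAMProg

/-- Repeat `P` for the values `0, …, e - 1` of the register `i`. -/
def RAMProg.forTo (i : ℕ) (e : RAMExpr) (P : RAMProg) : RAMProg :=
  setReg i (.const 0) ;; .loop (.sub e (.reg i)) (P ;; setReg i (.add (.reg i) (.const 1)))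

/-- The number of rounds is constant because `e` has the same value in all states that agree with
`s₀` outside the written banks. The invariant must not depend on the counter, which changes between
rounds; this is `hst`. -/
theorem Runs.forTo {B n i : ℕ} {e : RAMExpr} {P : RAMProg} {s₀ : RAMState}
    (I : ℕ → RAMState → Prop) (hn : n ≤ B) (hw : P.writes i = false)
    (he : ∀ s, Frame (RAMProg.forTo i e P) s₀ s → e.eval s = n)
    (hst : ∀ j s v, I j s → I j (s.write i 0 v)) (h₀ : I 0 s₀)
    (hstep : ∀ j s, j < n → Frame (RAMProg.forTo i e P) s₀ s → s i 0 = j → I j s →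
      Runs B P s (I (j + 1))) :
    Runs B (RAMProg.forTo i e P) s₀ (I n) := by
  have frw (s : RAMState) (v : ℕ) (h : Frame (RAMProg.forTo i e P) s₀ s) :
      Frame (RAMProg.forTo i e P) s₀ (s.write i 0 v) := by
    intro b hb
    rw [RAMState.write_ne, h b hb]
    rintro rfl
    simp [RAMProg.forTo, RAMProg.writes] at hb
  refine .seq (.assign (.loop hn (fun j s => Frame (RAMProg.forTo i e P) s₀ s ∧ s i 0 = j ∧ I j s)
    ⟨frw _ _ fun b _ => rfl, by simp [RAMExpr.eval], hst _ _ _ h₀⟩ ?_ ?_))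
  · rintro j s hj ⟨hf, hi, hI⟩
    refine ⟨by simp only [RAMExpr.eval, he s hf, hi]; omega, .seq ((hstep j s hj hf hi hI).mono ?_)⟩
    intro s' hf' hI'
    refine .assign ⟨frw _ _ fun b hb => ?_, ?_, hst _ _ _ hI'⟩
    · rw [← hf b hb]
      refine hf' b ?_
      simp only [RAMProg.forTo, RAMProg.writes, Bool.or_eq_false_iff] at hb
      exact hb.2.1
    · simp [RAMExpr.eval, hf' i hw, hi]
  · rintro s ⟨hf, hi, hI⟩
    exact ⟨by simp [RAMExpr.eval, he s hf, hi], hI⟩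

/-! ### Lists in memory -/

/-- The memory bank holds the list from the given address on. -/
def Holds (mem : ℕ → ℕ) (p : ℕ) (l : List ℕ) : Prop :=
  ∀ (i : ℕ) (h : i < l.length), mem (p + i) = l[i]

theorem holds_append {mem : ℕ → ℕ} {p : ℕ} {l l' : List ℕ} :
    Holds mem p (l ++ l') ↔ Holds mem p l ∧ Holds mem (p + l.length) l' := by
  constructor
  · intro h
    refine ⟨fun i hi => ?_, fun i hi => ?_⟩
    · rw [h i (by simp; omega), List.getElem_append_left hi]
    · rw [add_assoc, h _ (by simp; omega), List.getElem_append_right (by omega)]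
      simp
  · rintro ⟨h, h'⟩ i hi
    by_cases hil : i < l.length
    · rw [h i hil, List.getElem_append_left hil]
    · rw [List.getElem_append_right (by omega), ← h']
      congr 1
      omega

theorem holds_cons {mem : ℕ → ℕ} {p a : ℕ} {l : List ℕ} :
    Holds mem p (a :: l) ↔ mem p = a ∧ Holds mem (p + 1) l := by
  rw [← List.singleton_append, holds_append]
  simp [Holds]

theorem holds_nil {mem : ℕ → ℕ} {p : ℕ} : Holds mem p [] := fun _ h => absurd h (by simp)

theorem Holds.snoc {mem : ℕ → ℕ} {p q : ℕ} {l : List ℕ} (h : Holds mem p l) (hq : q = p + l.length)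
    (a : ℕ) : Holds (Function.update mem q a) p (l ++ [a]) := by
  subst hq
  refine holds_append.2 ⟨fun i hi => ?_, holds_cons.2 ⟨by simp, holds_nil⟩⟩
  rw [Function.update_of_ne (by omega), h i hi]

theorem Holds.update_lt {mem : ℕ → ℕ} {p q : ℕ} {l : List ℕ} (h : Holds mem p l) (hq : q < p)
    (a : ℕ) : Holds (Function.update mem q a) p l := fun i hi => by
  rw [Function.update_of_ne (by omega), h i hi]

theorem RAMState.holds_init (l : List ℕ) : Holds (RAMState.init l 0) 0 (l.length :: l) := by
  intro i hi
  simp [RAMState.init, List.getElem?_eq_getElem hi]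

theorem RAMState.hasOutput_iff {s : RAMState} {l : List ℕ} :
    s.HasOutput l ↔ s 1 0 = l.length ∧ Holds (s 1) 1 l := by
  rw [← zero_add 1, ← holds_cons]
  simp [RAMState.HasOutput, Holds]

/-! ### Systems of equations in memory -/

/-- An equation given by the list of its variables, its right-hand side and its weight. -/
structure FlatEq where
  vars : List ℕ
  b : ℕ
  w : ℕ

/-- The numbers that encode an equation. -/
def FlatEq.enc (e : FlatEq) : List ℕ := e.vars.length :: e.vars ++ [e.b, e.w]

theorem FlatEq.length_enc (e : FlatEq) : e.enc.length = e.vars.length + 3 := by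
  simp [enc]

/-- Run the body for every equation of the input. Register `2` points to the equation, and
register `3` counts the equations. -/
def RAMProg.eqLoop (P : RAMProg) : RAMProg :=
  setReg 2 (.const 4) ;; forTo 3 (.get 0 (.const 3))
    (P ;; setReg 2 (.add (.add (.reg 2) (.get 0 (.reg 2))) (.const 3)))

/-- Run the body for every variable of the current equation. Register `4` counts the variables, and
register `5` holds the variable. -/
def RAMProg.varLoop (P : RAMProg) : RAMProg :=
  forTo 4 (.get 0 (.reg 2)) (setReg 5 (.get 0 (.add (.add (.reg 2) (.const 1)) (.reg 4))) ;; P)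

/-- The invariant is indexed by the prefix already read, so that functions defined by recursion on
lists advance by one appended element per round. -/
theorem Runs.varLoop {B : ℕ} {P : RAMProg} {s₀ : RAMState} {e : FlatEq}
    (I : List ℕ → RAMState → Prop) (hB : e.vars.length ≤ B) (hs : Holds (s₀ 0) (s₀ 2 0) e.enc)
    (hw0 : P.writes 0 = false) (hw2 : P.writes 2 = false) (hw4 : P.writes 4 = false)
    (hst : ∀ l s v, I l s → I l (s.write 4 0 v)) (hst' : ∀ l s v, I l s → I l (s.write 5 0 v))
    (h₀ : I [] s₀)
    (hstep : ∀ l v l' s, e.vars = l ++ v :: l' → Frame (RAMProg.varLoop P) s₀ s → s 5 0 = v →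
      I l s → Runs B P s (I (l ++ [v]))) :
    Runs B (RAMProg.varLoop P) s₀ (I e.vars) := by
  have hwr0 : (RAMProg.varLoop P).writes 0 = false := by
    simp [RAMProg.varLoop, RAMProg.forTo, RAMProg.writes, hw0]
  have hwr2 : (RAMProg.varLoop P).writes 2 = false := by
    simp [RAMProg.varLoop, RAMProg.forTo, RAMProg.writes, hw2]
  have hs' := hs
  rw [FlatEq.enc, List.cons_append, holds_cons, holds_append] at hs'
  obtain ⟨hlen, hvars, -⟩ := hs'
  have := Runs.forTo (B := B) (n := e.vars.length) (i := 4) (e := .get 0 (.reg 2))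
    (P := RAMProg.setReg 5 (.get 0 (.add (.add (.reg 2) (.const 1)) (.reg 4))) ;; P) (s₀ := s₀)
    (fun j s => I (e.vars.take j) s) hB (by simp [RAMProg.writes, hw4]) ?_ ?_ (by simpa using h₀) ?_
  · exact this.mono fun s _ h => by simpa using h
  · intro s hf
    simp only [RAMExpr.eval]
    rw [hf 0 hwr0, hf 2 hwr2, hlen]
  · intro j s v h
    exact hst _ _ _ h
  · intro j s hj hf h4 hI
    have hv : e.vars = e.vars.take j ++ e.vars[j] :: e.vars.drop (j + 1) := by simp
    have hev : (RAMExpr.get 0 (.add (.add (.reg 2) (.const 1)) (.reg 4))).eval s = e.vars[j] := by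
      simp only [RAMExpr.eval]
      rw [hf 0 hwr0, hf 2 hwr2, h4, hvars j hj]
    refine .seq (.assign ?_)
    rw [hev, List.take_succ_eq_append_getElem hj]
    refine hstep _ _ _ _ hv (fun b hb => ?_) (by simp [RAMExpr.eval]) (hst' _ _ _ hI)
    rw [RAMState.write_ne]
    · exact hf b hb
    · rintro rfl
      simp [RAMProg.varLoop, RAMProg.forTo, RAMProg.writes] at hb

/-- Equations have different lengths, so the invariant also records that the pointer is past the
encoded prefix. The equations start at address `4`, after the input length, the parameter, `n` and
`m`. -/
theorem Runs.eqLoop {B : ℕ} {P : RAMProg} {s₀ : RAMState} {eqs : List FlatEq}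
    (I : List FlatEq → RAMState → Prop) (hB : eqs.length ≤ B) (hm : s₀ 0 3 = eqs.length)
    (hs : Holds (s₀ 0) 4 (eqs.flatMap FlatEq.enc))
    (hw0 : P.writes 0 = false) (hw2 : P.writes 2 = false) (hw3 : P.writes 3 = false)
    (hst : ∀ l s v, I l s → I l (s.write 2 0 v)) (hst' : ∀ l s v, I l s → I l (s.write 3 0 v))
    (h₀ : I [] s₀)
    (hstep : ∀ l e l' s, eqs = l ++ e :: l' → Frame (RAMProg.eqLoop P) s₀ s →
      Holds (s 0) (s 2 0) e.enc → I l s → Runs B P s (I (l ++ [e]))) :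
    Runs B (RAMProg.eqLoop P) s₀ (I eqs) := by
  have hwr0 : (RAMProg.eqLoop P).writes 0 = false := by
    simp [RAMProg.eqLoop, RAMProg.forTo, RAMProg.writes, hw0]
  have fr {s : RAMState} (hf : Frame (RAMProg.forTo 3 (.get 0 (.const 3))
      (P ;; RAMProg.setReg 2 (.add (.add (.reg 2) (.get 0 (.reg 2))) (.const 3))))
      (s₀.write 2 0 4) s) : Frame (RAMProg.eqLoop P) s₀ s := by
    intro b hb
    rw [hf b, RAMState.write_ne]
    · rintro rfl
      simp [RAMProg.eqLoop, RAMProg.forTo, RAMProg.writes] at hb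
    · simp only [RAMProg.eqLoop, RAMProg.writes, Bool.or_eq_false_iff] at hb
      exact hb.2
  refine .seq (.assign ?_)
  simp only [RAMExpr.eval]
  have := Runs.forTo (B := B) (n := eqs.length) (i := 3) (e := .get 0 (.const 3))
    (P := P ;; RAMProg.setReg 2 (.add (.add (.reg 2) (.get 0 (.reg 2))) (.const 3)))
    (s₀ := s₀.write 2 0 4)
    (fun j s => s 2 0 = 4 + ((eqs.take j).flatMap FlatEq.enc).length ∧ I (eqs.take j) s) hB
    (by simp [RAMProg.writes, hw3]) ?_ ?_ ⟨by simp, by simpa using hst _ _ _ h₀⟩ ?_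
  · exact this.mono fun s _ h => by simpa using h.2
  · intro s hf
    simp only [RAMExpr.eval]
    rw [fr hf 0 hwr0, hm]
  · rintro j s v ⟨h, hI⟩
    exact ⟨by simpa using h, hst' _ _ _ hI⟩
  · rintro j s hj hf h3 ⟨h2, hI⟩
    have hv : eqs = eqs.take j ++ eqs[j] :: eqs.drop (j + 1) := by simp
    have hH : Holds (s 0) (s 2 0) eqs[j].enc := by
      rw [fr hf 0 hwr0, h2]
      rw [hv, List.flatMap_append, holds_append, List.flatMap_cons, holds_append] at hs
      exact hs.2.1
    refine .seq ((hstep _ _ _ _ hv (fr hf) hH hI).mono fun s' hf' hJ => .assign ⟨?_, ?_⟩)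
    · have : s 0 (s 2 0) = eqs[j].vars.length := by
        rw [FlatEq.enc, List.cons_append, holds_cons] at hH
        exact hH.1
      simp only [RAMExpr.eval, RAMState.write_self, Function.update_self]
      rw [hf' 2 hw2, hf' 0 hw0, this, h2, List.take_succ_eq_append_getElem hj, List.flatMap_append,
        List.length_append, List.flatMap_singleton, FlatEq.length_enc]
      omega
    · rw [List.take_succ_eq_append_getElem hj]
      exact hst _ _ _ hJ

/-! ### Integral combinations of characters of `𝔽₂ⁿ` -/

theorem add_eq_zero_iff_eq_of_zmod_two {V : Type*} {u v : V → ZMod 2} : u + v = 0 ↔ u = v := by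
  have : ∀ a b : ZMod 2, a + b = 0 ↔ a = b := by decide
  simp only [funext_iff, Pi.add_apply, Pi.zero_apply, this]

/-- A coordinate that is nonzero in some element of `M` is nonzero in half of the sums. -/
theorem two_mul_sum_powerset_ite {V : Type*} (M : Finset (V → ZMod 2)) {i : V} {u : V → ZMod 2}
    (hu : u ∈ M) (hi : u i ≠ 0) :
    2 * ∑ J ∈ M.powerset, (if (∑ v ∈ J, v) i ≠ 0 then 1 else 0) = 2 ^ M.card := by
  classical
  -- Pair each `J` avoiding `u` with `J ∪ {u}`: exactly one of the two sums is nonzero at `i`.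
  obtain ⟨M', hM', rfl⟩ : ∃ M', u ∉ M' ∧ M = insert u M' :=
    ⟨M.erase u, Finset.notMem_erase u M, (Finset.insert_erase hu).symm⟩
  rw [Finset.sum_powerset_insert hM', Finset.card_insert_of_notMem hM', pow_succ, mul_comm,
    ← Finset.sum_add_distrib, ← Finset.card_powerset, Finset.card_eq_sum_ones]
  congr 1
  refine Finset.sum_congr rfl fun J hJ => ?_
  rw [Finset.sum_insert fun h => hM' (Finset.mem_powerset.1 hJ h), Pi.add_apply]
  have : ∀ a b : ZMod 2, a ≠ 0 →
      ((if b ≠ 0 then 1 else 0) + if a + b ≠ 0 then 1 else 0) = 1 := by decide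
  exact this _ _ hi

section Fourier

variable {V : Type*} [Fintype V]

/-- The character of `V → 𝔽₂` given by `u`. -/
def chi (u z : V → ZMod 2) : ℤ := ∏ i, if u i = 0 ∨ z i = 0 then 1 else -1

theorem chi_zero (z : V → ZMod 2) : chi 0 z = 1 := by simp [chi]

theorem chi_add (u u' z : V → ZMod 2) : chi (u + u') z = chi u z * chi u' z := by
  rw [chi, chi, chi, ← Finset.prod_mul_distrib]
  refine Finset.prod_congr rfl fun i _ => ?_
  rw [Pi.add_apply]
  generalize u i = a, u' i = b, z i = c
  revert a b c
  decide

theorem chi_sum (I : Finset (V → ZMod 2)) (z : V → ZMod 2) :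
    chi (∑ u ∈ I, u) z = ∏ u ∈ I, chi u z := by
  classical
  induction I using Finset.induction_on with
  | empty => simp [chi_zero]
  | insert a I ha ih => rw [Finset.sum_insert ha, Finset.prod_insert ha, chi_add, ih]

theorem chi_eq_one_or (u z : V → ZMod 2) : chi u z = 1 ∨ chi u z = -1 := by
  refine Finset.prod_induction _ (fun a : ℤ => a = 1 ∨ a = -1) ?_ (.inl rfl) ?_
  · rintro a b (rfl | rfl) (rfl | rfl) <;> simp
  · intro i _
    split_ifs <;> simp

/-- If the supports of the elements of `M` cover `U`, some sum of elements of `M` is nonzero in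
half of the coordinates in `U`. -/
theorem exists_card_le_two_mul (M : Finset (V → ZMod 2)) (U : Finset V)
    (hU : ∀ i ∈ U, ∃ u ∈ M, u i ≠ 0) :
    ∃ J ⊆ M, U.card ≤ 2 * (Finset.univ.filter fun i => (∑ u ∈ J, u) i ≠ 0).card := by
  -- Average over all subsets `J`: each coordinate in `U` is nonzero in half of the sums.
  have key : ∑ J ∈ M.powerset, U.card ≤
      ∑ J ∈ M.powerset, 2 * (U.filter fun i => (∑ u ∈ J, u) i ≠ 0).card := by
    simp only [Finset.card_filter, Finset.mul_sum]
    rw [Finset.sum_comm, Finset.sum_const, Finset.card_powerset, smul_eq_mul, mul_comm,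
      ← smul_eq_mul, ← Finset.sum_const]
    refine Finset.sum_le_sum fun i hi => ?_
    obtain ⟨u, hu, hui⟩ := hU i hi
    rw [← Finset.mul_sum, two_mul_sum_powerset_ite M hu hui]
  obtain ⟨J, hJ, h⟩ := Finset.exists_le_of_sum_le ⟨∅, Finset.empty_mem_powerset M⟩ key
  refine ⟨J, Finset.mem_powerset.1 hJ, h.trans ?_⟩
  gcongr
  exact Finset.subset_univ U

/-! ### Riesz products and lower bounds for the maximum. -/

variable [DecidableEq V]

/-- Orthogonality of characters: the sum factors over the coordinates, and the factor of a
coordinate with `u i ≠ 0` vanishes. -/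
theorem sum_chi (u : V → ZMod 2) :
    ∑ z, chi u z = if u = 0 then 2 ^ Fintype.card V else 0 := by
  split_ifs with h
  · subst h
    simp [chi_zero, ZMod.card]
  · obtain ⟨i, hi⟩ := Function.ne_iff.1 h
    have : ∑ z, chi u z = ∏ i, ∑ a : ZMod 2, if u i = 0 ∨ a = 0 then (1 : ℤ) else -1 := by
      rw [Finset.prod_univ_sum, Fintype.piFinset_univ]
      rfl
    rw [this]
    refine Finset.prod_eq_zero (Finset.mem_univ i) ?_
    have : ∀ a : ZMod 2, a ≠ 0 → (∑ b : ZMod 2, if a = 0 ∨ b = 0 then (1 : ℤ) else -1) = 0 := by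
      decide
    exact this _ hi

/-- If no nonempty part of `K` sums to `0` and no part of at least two elements sums into the
support of `c`, then the function with coefficients `c` attains at least `∑ u ∈ K, |c u|`. -/
theorem exists_le_of_sumFree (c : (V → ZMod 2) → ℤ) (K : Finset (V → ZMod 2)) (hc : c 0 = 0)
    (hK : ∀ I ⊆ K, I.Nonempty → ∑ u ∈ I, u ≠ 0)
    (hK' : ∀ I ⊆ K, 2 ≤ I.card → c (∑ u ∈ I, u) = 0) :
    ∃ z, ∑ u ∈ K, |c u| ≤ ∑ u, c u * chi u z := by
  set N : ℤ := 2 ^ Fintype.card V with hN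
  have hNpos : 0 < N := by positivity
  let ε : (V → ZMod 2) → ℤ := fun u => if c u < 0 then -1 else 1
  have hε (u) : ε u * c u = |c u| := by
    by_cases h : c u < 0
    · simp [ε, h, abs_of_neg]
    · simp [ε, h, abs_of_nonneg (not_lt.1 h)]
  -- The Riesz product. Each factor is `0` or `2`, and expanding it gives one character for each
  -- subset sum of `K`.
  let W : (V → ZMod 2) → ℤ := fun z => ∏ u ∈ K, (1 + ε u * chi u z)
  have hW (z) : 0 ≤ W z := by
    refine Finset.prod_nonneg fun u _ => ?_
    rcases chi_eq_one_or u z with h | h <;> by_cases h' : c u < 0 <;> simp [ε, h, h']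
  have hWsum (z) : W z = ∑ I ∈ K.powerset, (∏ u ∈ I, ε u) * chi (∑ u ∈ I, u) z := by
    simp only [W, Finset.prod_one_add, Finset.prod_mul_distrib, chi_sum]
  have hsum (u : V → ZMod 2) : ∑ z, chi u z * W z =
      ∑ I ∈ K.powerset, (∏ u ∈ I, ε u) * if u = ∑ v ∈ I, v then N else 0 := by
    simp only [hWsum, Finset.mul_sum]
    rw [Finset.sum_comm]
    refine Finset.sum_congr rfl fun I _ => ?_
    have hz (z : V → ZMod 2) : chi u z * ((∏ u ∈ I, ε u) * chi (∑ u ∈ I, u) z) =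
        (∏ u ∈ I, ε u) * chi (u + ∑ v ∈ I, v) z := by
      rw [chi_add]
      ring
    simp only [hz, ← Finset.mul_sum, sum_chi, add_eq_zero_iff_eq_of_zmod_two]
    rfl
  have h1 : ∑ z, W z = N := by
    have := hsum 0
    simp only [chi_zero, one_mul] at this
    rw [this, Finset.sum_eq_single ∅]
    · simp
    · intro I hI hne
      rw [if_neg (hK I (Finset.mem_powerset.1 hI) (Finset.nonempty_iff_ne_empty.2 hne)).symm,
        mul_zero]
    · simp
  have h2 : ∑ z, (∑ u, c u * chi u z) * W z = N * ∑ u ∈ K, |c u| := by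
    have e1 : ∑ z, (∑ u, c u * chi u z) * W z = ∑ u, c u * ∑ z, chi u z * W z := by
      simp only [Finset.sum_mul, Finset.mul_sum]
      rw [Finset.sum_comm]
      simp only [mul_assoc]
    have e2 : ∑ u, c u * ∑ z, chi u z * W z =
        ∑ I ∈ K.powerset, (∏ u ∈ I, ε u) * c (∑ v ∈ I, v) * N := by
      simp only [hsum, Finset.mul_sum]
      rw [Finset.sum_comm]
      refine Finset.sum_congr rfl fun I _ => ?_
      rw [Finset.sum_eq_single (∑ v ∈ I, v)]
      · rw [if_pos rfl]
        ring
      · intro u _ hu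
        rw [if_neg hu]
        ring
      · simp
    -- Only one-element subsets contribute: the empty one gives `c 0 = 0`, and larger ones sum
    -- outside the support of `c`.
    rw [e1, e2, ← Finset.sum_subset (s₁ := K.powersetCard 1)
      (fun I hI => Finset.mem_powerset.2 (Finset.mem_powersetCard.1 hI).1)]
    · rw [Finset.powersetCard_one, Finset.sum_map, Finset.mul_sum]
      refine Finset.sum_congr rfl fun u _ => ?_
      simp [hε, mul_comm]
    · intro I hI hI1
      have hIK := Finset.mem_powerset.1 hI
      have hcard : I.card ≠ 1 := fun h => hI1 (Finset.mem_powersetCard.2 ⟨hIK, h⟩)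
      rcases I.eq_empty_or_nonempty with rfl | hne
      · simp [hc]
      · have := hne.card_pos
        rw [hK' I hIK (by omega)]
        ring
  -- Otherwise integrality makes every value at most the claimed one minus `1`, which contradicts
  -- the weighted mean `h2` because `W` has total mass `N > 0`.
  by_contra! hlt
  have h3 : ∑ z, (∑ u, c u * chi u z) * W z ≤ ∑ z, (∑ u ∈ K, |c u| - 1) * W z :=
    Finset.sum_le_sum fun z _ => mul_le_mul_of_nonneg_right (by linarith [hlt z]) (hW z)
  rw [h2, ← Finset.mul_sum, h1] at h3
  linarith

/-- The function with coefficients `c` attains the absolute value of each coefficient. -/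
theorem exists_abs_coeff_le (c : (V → ZMod 2) → ℤ) (hc : c 0 = 0) (u : V → ZMod 2) :
    ∃ z, |c u| ≤ ∑ u, c u * chi u z := by
  by_cases hu : u = 0
  · obtain ⟨z, hz⟩ := exists_le_of_sumFree c ∅ hc (by simp) (by simp +contextual)
    exact ⟨z, by simpa [hu, hc] using hz⟩
  · have h1 : ∀ I ⊆ {u}, I.Nonempty → ∑ v ∈ I, v ≠ 0 := fun I hI hne => by
      rw [(Finset.subset_singleton_iff.1 hI).resolve_left hne.ne_empty]
      simpa using hu
    have h2 : ∀ I ⊆ {u}, 2 ≤ I.card → c (∑ v ∈ I, v) = 0 := fun I hI h2 => by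
      have := Finset.card_le_card hI
      rw [Finset.card_singleton] at this
      omega
    obtain ⟨z, hz⟩ := exists_le_of_sumFree c {u} hc h1 h2
    exact ⟨z, by simpa using hz⟩

/-- If every element of the support of `c` has at most `r` nonzero coordinates and these cover
at least `2 * r * k` coordinates, then the function with coefficients `c` attains at least `k`. -/
theorem exists_le_of_cover (c : (V → ZMod 2) → ℤ) (hc : c 0 = 0) {r k : ℕ} (hr : 0 < r)
    (hcr : ∀ u, c u ≠ 0 → (Finset.univ.filter fun i => u i ≠ 0).card ≤ r) (U : Finset V)
    (hU : ∀ i ∈ U, ∃ u, c u ≠ 0 ∧ u i ≠ 0) (hk : 2 * r * k ≤ U.card) :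
    ∃ z, (k : ℤ) ≤ ∑ u, c u * chi u z := by
  set M : Finset (V → ZMod 2) := Finset.univ.filter fun u => c u ≠ 0 with hM
  have memM (u) : u ∈ M ↔ c u ≠ 0 := by simp [hM]
  obtain ⟨J, hJ, hcard⟩ := exists_card_le_two_mul M U (by simpa [memM] using hU)
  -- Among all subsets of the support with the same sum as `J`, a smallest one has no removable or
  -- contractible part.
  obtain ⟨K, hKmem, hmin⟩ := Finset.exists_min_image
    (M.powerset.filter fun I => ∑ u ∈ I, u = ∑ u ∈ J, u) Finset.card ⟨J, by simpa using hJ⟩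
  obtain ⟨hKM, hKJ⟩ := by simpa using hKmem
  have hmin' : ∀ I ⊆ M, ∑ u ∈ I, u = ∑ u ∈ J, u → K.card ≤ I.card :=
    fun I hI h => hmin I (by simpa using ⟨hI, h⟩)
  have hsub {I : Finset (V → ZMod 2)} (hI : I ⊆ K) :
      ∑ u ∈ K \ I, u + ∑ u ∈ I, u = ∑ u ∈ J, u := (Finset.sum_sdiff hI).trans hKJ
  have hKcard : k ≤ K.card := by
    have h1 : (Finset.univ.filter fun i => (∑ u ∈ J, u) i ≠ 0).card ≤ K.card * r := by
      refine (Finset.card_le_card fun i hi => ?_).trans (Finset.card_biUnion_le_card_mul K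
        (fun u => Finset.univ.filter fun i => u i ≠ 0) r
        fun u hu => hcr u ((memM u).1 (hKM hu)))
      rw [← hKJ, Finset.mem_filter, Finset.sum_apply] at hi
      obtain ⟨u, hu, hui⟩ := Finset.exists_ne_zero_of_sum_ne_zero hi.2
      exact Finset.mem_biUnion.2 ⟨u, hu, by simpa using hui⟩
    have h2 : 2 * r * k ≤ 2 * r * K.card := by
      calc 2 * r * k ≤ _ := hk
        _ ≤ _ := hcard
        _ ≤ 2 * (K.card * r) := by gcongr
        _ = _ := by ring
    exact Nat.le_of_mul_le_mul_left h2 (by positivity)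
  have main := exists_le_of_sumFree c K hc ?_ ?_
  · obtain ⟨z, hz⟩ := main
    refine ⟨z, le_trans ?_ hz⟩
    calc (k : ℤ) ≤ ∑ u ∈ K, (1 : ℤ) := by simpa using hKcard
      _ ≤ _ := Finset.sum_le_sum fun u hu => Int.one_le_abs ((memM u).1 (hKM hu))
  · intro I hI hne h0
    have h := hsub hI
    rw [h0, add_zero] at h
    have := hmin' (K \ I) (Finset.sdiff_subset.trans hKM) h
    have h2 := Finset.card_sdiff_add_card_eq_card hI
    have := hne.card_pos
    omega
  · intro I hI h2
    by_contra hcI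
    set u := ∑ u ∈ I, u with hu
    have h := hsub hI
    have h3 := Finset.card_sdiff_add_card_eq_card hI
    -- Replace the part `I` by its sum `u`; if `u` already occurs in the rest, the two copies
    -- cancel. Either way the sum is kept and the set gets smaller, as `I` has at least two
    -- elements.
    by_cases huI : u ∈ K \ I
    · have := hmin' ((K \ I).erase u)
        ((Finset.erase_subset _ _).trans (Finset.sdiff_subset.trans hKM)) (by
          rw [← h, ← Finset.sum_erase_add _ _ huI, add_assoc,
            add_eq_zero_iff_eq_of_zmod_two.2 rfl, add_zero])
      have h4 := Finset.card_erase_le (s := K \ I) (a := u)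
      omega
    · have := hmin' (insert u (K \ I))
        (Finset.insert_subset ((memM u).2 hcI) (Finset.sdiff_subset.trans hKM)) (by
          rw [Finset.sum_insert huI, add_comm, h])
      rw [Finset.card_insert_of_notMem huI] at this
      omega

end Fourier

/-! ### Excess of a system of equations as a combination of monomials -/

namespace FlatEq

/-- The weight, with a negative sign if the right-hand side is not `0`. -/
def sw (e : FlatEq) : ℤ := if e.b = 0 then e.w else -e.w

/-- The set of variables. -/
def varSet (e : FlatEq) : Finset ℕ := e.vars.toFinset

/-- The equation belongs to a system in `n` variables with at most `r` variables per equation. -/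
structure Valid (r n : ℕ) (e : FlatEq) : Prop where
  sorted : e.vars.Pairwise (· < ·)
  lt : ∀ v ∈ e.vars, v < n
  ne_nil : e.vars ≠ []
  length_le : e.vars.length ≤ r
  b_lt : e.b < 2
  w_pos : 0 < e.w

theorem Valid.nodup {r n : ℕ} {e : FlatEq} (h : e.Valid r n) : e.vars.Nodup :=
  h.sorted.imp fun h => h.ne

end FlatEq

/-- The excess of the assignment that sends `v` to `0` or `1` according to whether `x v` is `1`
or `-1`. -/
def exc (l : List FlatEq) (x : ℕ → ℤ) : ℤ := (l.map fun e => e.sw * (e.vars.map x).prod).sum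

/-- The total signed weight of the equations to which `φ` assigns the value `a`. -/
def coef {α : Type*} [DecidableEq α] (φ : FlatEq → α) (l : List FlatEq) (a : α) : ℤ :=
  ((l.filter fun e => φ e = a).map FlatEq.sw).sum

section coef

variable {α β : Type*} [DecidableEq α] [DecidableEq β]

theorem coef_cons (φ : FlatEq → α) (e : FlatEq) (l : List FlatEq) (a : α) :
    coef φ (e :: l) a = (if φ e = a then e.sw else 0) + coef φ l a := by
  by_cases h : φ e = a <;> simp [coef, h]

/-- Equations are grouped by variable sets, by indicator vectors and by numerical keys; this
transfers coefficients between the three indexings. -/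
theorem coef_congr {φ : FlatEq → α} {ψ : FlatEq → β} {l : List FlatEq} {a : α} {b : β}
    (h : ∀ e ∈ l, φ e = a ↔ ψ e = b) : coef φ l a = coef ψ l b := by
  have : (l.filter fun e => φ e = a) = l.filter fun e => ψ e = b :=
    List.filter_congr fun e he => by simp only [h e he]
  rw [coef, coef, this]

theorem exists_of_coef_ne_zero {φ : FlatEq → α} {l : List FlatEq} {a : α} (h : coef φ l a ≠ 0) :
    ∃ e ∈ l, φ e = a := by
  by_contra! hne
  refine h ?_
  rw [coef, List.filter_eq_nil_iff.2 (by simpa using hne)]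
  rfl

theorem sum_map_sw_mul (φ : FlatEq → α) (g : α → ℤ) (l : List FlatEq) (U : Finset α)
    (hU : ∀ e ∈ l, φ e ∈ U) :
    (l.map fun e => e.sw * g (φ e)).sum = ∑ a ∈ U, coef φ l a * g a := by
  induction l with
  | nil => simp [coef]
  | cons e l ih =>
    simp only [List.map_cons, List.sum_cons, coef_cons, add_mul, Finset.sum_add_distrib, ite_mul,
      zero_mul, Finset.sum_ite_eq, hU e List.mem_cons_self, if_true]
    rw [ih fun e' he' => hU e' (List.mem_cons_of_mem _ he')]

end coef

theorem exc_eq_sum {l : List FlatEq} (hl : ∀ e ∈ l, e.vars.Nodup) (U : Finset (Finset ℕ))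
    (hU : ∀ e ∈ l, e.varSet ∈ U) (x : ℕ → ℤ) :
    exc l x = ∑ T ∈ U, coef FlatEq.varSet l T * ∏ v ∈ T, x v := by
  rw [← sum_map_sw_mul FlatEq.varSet (fun T => ∏ v ∈ T, x v) l U hU, exc]
  congr 1
  refine List.map_congr_left fun e he => ?_
  rw [FlatEq.varSet, List.prod_toFinset _ (hl e he)]

/-- The excess depends only on the variables of the equations whose total signed weight is
nonzero. -/
theorem exc_congr {l : List FlatEq} (hl : ∀ e ∈ l, e.vars.Nodup) {x y : ℕ → ℤ}
    (h : ∀ e ∈ l, coef FlatEq.varSet l e.varSet ≠ 0 → ∀ v ∈ e.vars, x v = y v) :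
    exc l x = exc l y := by
  have hU : ∀ e ∈ l, e.varSet ∈ (l.map FlatEq.varSet).toFinset := fun e he => by
    simpa using ⟨e, he, rfl⟩
  rw [exc_eq_sum hl _ hU, exc_eq_sum hl _ hU]
  refine Finset.sum_congr rfl fun T hT => ?_
  obtain ⟨e, he, rfl⟩ : ∃ e ∈ l, e.varSet = T := by simpa using hT
  by_cases h0 : coef FlatEq.varSet l e.varSet = 0
  · simp [h0]
  · rw [Finset.prod_congr rfl fun v hv => h e he h0 v (by simpa [FlatEq.varSet] using hv)]

/-! ### Assignments as sign functions, and the excess as a combination of characters. -/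

/-- The values `1` and `-1` that represent an assignment, extended by `1`. -/
def signs {n : ℕ} (z : Fin n → ZMod 2) (v : ℕ) : ℤ :=
  if h : v < n then if z ⟨v, h⟩ = 0 then 1 else -1 else 1

/-- All values are `1` or `-1`. -/
def IsSign (x : ℕ → ℤ) : Prop := ∀ v, x v = 1 ∨ x v = -1

theorem isSign_signs {n : ℕ} (z : Fin n → ZMod 2) : IsSign (signs z) := by
  intro v
  unfold signs
  split_ifs <;> simp

/-- The indicator vector of the variables of an equation. -/
def FlatEq.ind (n : ℕ) (e : FlatEq) : Fin n → ZMod 2 := fun i => if (i : ℕ) ∈ e.vars then 1 else 0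

theorem FlatEq.Valid.prod_signs {r n : ℕ} {e : FlatEq} (h : e.Valid r n) (z : Fin n → ZMod 2) :
    (e.vars.map (signs z)).prod = chi (e.ind n) z := by
  rw [← List.prod_toFinset _ h.nodup]
  have h1 : chi (e.ind n) z = ∏ i : Fin n, if (i : ℕ) ∈ e.vars.toFinset then signs z i else 1 := by
    refine Finset.prod_congr rfl fun i _ => ?_
    by_cases hi : (i : ℕ) ∈ e.vars <;> simp [FlatEq.ind, signs, hi]
  rw [h1, ← Finset.prod_range fun v => if v ∈ e.vars.toFinset then signs z v else 1,
    Finset.prod_ite_mem, Finset.inter_eq_right.2]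
  intro v hv
  simpa using h.lt v (by simpa using hv)

section Valid

variable {r n : ℕ} {l : List FlatEq}

theorem FlatEq.Valid.ind_eq_iff {e e' : FlatEq} (h : e.Valid r n) (h' : e'.Valid r n) :
    e.ind n = e'.ind n ↔ e.varSet = e'.varSet := by
  constructor
  · intro heq
    ext v
    simp only [FlatEq.varSet, List.mem_toFinset]
    by_cases hv : v < n
    · have := congrFun heq ⟨v, hv⟩
      by_cases h1 : v ∈ e.vars <;> by_cases h2 : v ∈ e'.vars <;> simp_all [FlatEq.ind]
    · exact ⟨fun hm => absurd (h.lt v hm) hv, fun hm => absurd (h'.lt v hm) hv⟩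
  · intro heq
    ext i
    have := Finset.ext_iff.1 heq i
    simp only [FlatEq.varSet, List.mem_toFinset] at this
    simp [FlatEq.ind, this]

theorem exc_signs (hl : ∀ e ∈ l, e.Valid r n) (z : Fin n → ZMod 2) :
    exc l (signs z) = ∑ u, coef (FlatEq.ind n) l u * chi u z := by
  rw [← sum_map_sw_mul (FlatEq.ind n) (fun u => chi u z) l _ fun _ _ => Finset.mem_univ _, exc]
  congr 1
  refine List.map_congr_left fun e he => ?_
  rw [(hl e he).prod_signs]

/-- Every equation has a variable, so no indicator vector vanishes: the average excess is `0`. -/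
theorem coef_ind_zero (hl : ∀ e ∈ l, e.Valid r n) : coef (FlatEq.ind n) l 0 = 0 := by
  by_contra h
  obtain ⟨e, he, h0⟩ := exists_of_coef_ne_zero h
  obtain ⟨v, hv⟩ := List.exists_mem_of_ne_nil _ (hl e he).ne_nil
  have := congrFun h0 ⟨v, (hl e he).lt v hv⟩
  simp [FlatEq.ind, hv] at this

theorem coef_ind_eq (hl : ∀ e ∈ l, e.Valid r n) {e : FlatEq} (he : e ∈ l) :
    coef (FlatEq.ind n) l (e.ind n) = coef FlatEq.varSet l e.varSet :=
  coef_congr fun e' he' => (hl e' he').ind_eq_iff (hl e he)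

/-- First criterion for the answer yes: one heavy merged equation suffices. -/
theorem exists_le_exc_of_coef (hl : ∀ e ∈ l, e.Valid r n) {e : FlatEq} (he : e ∈ l) :
    ∃ x, IsSign x ∧ |coef FlatEq.varSet l e.varSet| ≤ exc l x := by
  obtain ⟨z, hz⟩ := exists_abs_coeff_le (coef (FlatEq.ind n) l) (coef_ind_zero hl) (e.ind n)
  exact ⟨signs z, isSign_signs z, by rwa [exc_signs hl, ← coef_ind_eq hl he]⟩

/-- Second criterion for the answer yes: many variables in equations that do not cancel suffice. -/
theorem exists_le_exc_of_cover (hl : ∀ e ∈ l, e.Valid r n) (hr : 0 < r) {k : ℕ} {D : List ℕ}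
    (hD : D.Nodup)
    (hmem : ∀ v ∈ D, ∃ e ∈ l, coef FlatEq.varSet l e.varSet ≠ 0 ∧ v ∈ e.vars)
    (hk : 2 * r * k ≤ D.length) : ∃ x, IsSign x ∧ (k : ℤ) ≤ exc l x := by
  have main := exists_le_of_cover (coef (FlatEq.ind n) l) (coef_ind_zero hl) (k := k) hr
    (fun u hu => ?_) (Finset.univ.filter fun i : Fin n => (i : ℕ) ∈ D) (fun i hi => ?_) ?_
  · obtain ⟨z, hz⟩ := main
    exact ⟨signs z, isSign_signs z, by rwa [exc_signs hl]⟩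
  · obtain ⟨e, he, rfl⟩ := exists_of_coef_ne_zero hu
    rw [← Finset.card_map Fin.valEmbedding]
    refine (Finset.card_le_card (t := e.vars.toFinset) fun v hv => ?_).trans
      ((List.toFinset_card_le _).trans (hl e he).length_le)
    obtain ⟨i, hi, rfl⟩ := Finset.mem_map.1 hv
    have := (Finset.mem_filter.1 hi).2
    simpa [FlatEq.ind] using this
  · obtain ⟨e, he, h0, hv⟩ := hmem i (by simpa using hi)
    exact ⟨e.ind n, by rwa [coef_ind_eq hl he], by simp [FlatEq.ind, hv]⟩
  · refine hk.trans ?_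
    rw [← List.toFinset_card_of_nodup hD, ← Finset.card_map Fin.valEmbedding]
    refine Finset.card_le_card fun v hv => ?_
    have hv' : v ∈ D := by simpa using hv
    obtain ⟨e, he, -, hve⟩ := hmem v hv'
    exact Finset.mem_map.2 ⟨⟨v, (hl e he).lt v hve⟩, by simpa using hv', rfl⟩

end Valid

/-! ### Merging equations and renaming variables -/

/-- The merged equation that represents all equations with the same variables as `e`; a variable is
renamed to its position in the list `D`. -/
def FlatEq.reduce (l : List FlatEq) (D : List ℕ) (e : FlatEq) : FlatEq where
  vars := (List.range D.length).filter fun i => i ∈ e.vars.map D.idxOf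
  b := if coef FlatEq.varSet l e.varSet < 0 then 1 else 0
  w := (coef FlatEq.varSet l e.varSet).natAbs

theorem FlatEq.sw_reduce (l : List FlatEq) (D : List ℕ) (e : FlatEq) :
    (e.reduce l D).sw = coef FlatEq.varSet l e.varSet := by
  by_cases h : coef FlatEq.varSet l e.varSet < 0 <;> simp only [sw, reduce, h, if_true,
    if_false, one_ne_zero] <;> omega

section reduce

variable {l R : List FlatEq} {D : List ℕ}

theorem FlatEq.reduce_vars_toFinset {e : FlatEq} (hD : ∀ v ∈ e.vars, v ∈ D) :
    (e.reduce l D).vars.toFinset = e.varSet.image D.idxOf := by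
  ext i
  simp only [reduce, varSet, List.mem_toFinset, List.mem_filter, List.mem_range, Finset.mem_image,
    List.mem_map, decide_eq_true_eq, and_iff_right_iff_imp, forall_exists_index, and_imp]
  rintro v hv rfl
  exact List.idxOf_lt_length_of_mem (hD v hv)

theorem FlatEq.injOn_idxOf {e : FlatEq} (hD : ∀ v ∈ e.vars, v ∈ D) :
    Set.InjOn D.idxOf (e.varSet : Set ℕ) := by
  intro v hv v' hv' h
  exact (List.idxOf_inj (hD v (by simpa [varSet] using hv))).1 h

theorem FlatEq.nodup_reduce_vars (e : FlatEq) : (e.reduce l D).vars.Nodup :=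
  List.nodup_range.filter _

theorem FlatEq.valid_reduce {r n : ℕ} {e : FlatEq} (he : e.Valid r n) (hD : ∀ v ∈ e.vars, v ∈ D)
    (h0 : coef FlatEq.varSet l e.varSet ≠ 0) : (e.reduce l D).Valid r D.length where
  sorted := List.pairwise_lt_range.filter _
  lt v hv := List.mem_range.1 (List.mem_filter.1 hv).1
  ne_nil := by
    obtain ⟨v, hv⟩ := List.exists_mem_of_ne_nil _ he.ne_nil
    have := FlatEq.reduce_vars_toFinset (l := l) hD
    rintro h
    rw [h, eq_comm, List.toFinset_nil, Finset.image_eq_empty, varSet, List.toFinset_eq_empty_iff]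
      at this
    exact he.ne_nil this
  length_le := by
    rw [← List.toFinset_card_of_nodup e.nodup_reduce_vars, FlatEq.reduce_vars_toFinset hD]
    exact Finset.card_image_le.trans ((List.toFinset_card_le _).trans he.length_le)
  b_lt := by
    simp only [reduce]
    split_ifs <;> omega
  w_pos := Int.natAbs_pos.2 h0

/-- The list `R` contains one equation for every set of variables of nonzero total signed weight,
and `D` lists the variables of these equations. -/
structure IsReduction (l R : List FlatEq) (D : List ℕ) : Prop where
  subset : ∀ e ∈ R, e ∈ l
  nodup : (R.map FlatEq.varSet).Nodup
  ne_zero : ∀ e ∈ R, coef FlatEq.varSet l e.varSet ≠ 0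
  exists_mem : ∀ e ∈ l, coef FlatEq.varSet l e.varSet ≠ 0 → ∃ e' ∈ R, e'.varSet = e.varSet
  mem : ∀ e ∈ l, coef FlatEq.varSet l e.varSet ≠ 0 → ∀ v ∈ e.vars, v ∈ D

/-- Renaming is injective on the variables in `D`, so the monomial of each representative in `R`
becomes the monomial of the renamed set; all sets without a representative have coefficient `0`. -/
theorem IsReduction.exc_reduce (h : IsReduction l R D) (hl : ∀ e ∈ l, e.vars.Nodup) (y : ℕ → ℤ) :
    exc (R.map (FlatEq.reduce l D)) y = exc l fun v => y (D.idxOf v) := by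
  have hU : ∀ e ∈ l, e.varSet ∈ (l.map FlatEq.varSet).toFinset := fun e he => by
    simpa using ⟨e, he, rfl⟩
  let g : Finset ℕ → ℤ := fun T => coef FlatEq.varSet l T * ∏ v ∈ T, y (D.idxOf v)
  have h1 : exc (R.map (FlatEq.reduce l D)) y = ((R.map FlatEq.varSet).map g).sum := by
    rw [exc, List.map_map, List.map_map]
    congr 1
    refine List.map_congr_left fun e he => ?_
    have hD := h.mem e (h.subset e he) (h.ne_zero e he)
    simp only [Function.comp_apply, FlatEq.sw_reduce, g]
    rw [← List.prod_toFinset _ (FlatEq.nodup_reduce_vars e), FlatEq.reduce_vars_toFinset hD,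
      Finset.prod_image (FlatEq.injOn_idxOf hD)]
  rw [h1, ← List.sum_toFinset _ h.nodup, exc_eq_sum hl _ hU]
  refine Finset.sum_subset (fun T hT => ?_) fun T hT hTR => ?_
  · obtain ⟨e, he, rfl⟩ : ∃ e ∈ R, e.varSet = T := by simpa using hT
    exact hU e (h.subset e he)
  · obtain ⟨e, he, rfl⟩ : ∃ e ∈ l, e.varSet = T := by simpa using hT
    by_contra hne
    obtain ⟨e', he', heq⟩ := h.exists_mem e he fun h0 => hne (by simp [h0])
    exact hTR (by simpa using ⟨e', he', heq⟩)

theorem IsReduction.exists_le_exc_iff (h : IsReduction l R D) (hl : ∀ e ∈ l, e.vars.Nodup)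
    (k : ℤ) : (∃ x, IsSign x ∧ k ≤ exc (R.map (FlatEq.reduce l D)) x) ↔
      ∃ x, IsSign x ∧ k ≤ exc l x := by
  constructor
  · rintro ⟨y, hy, hk⟩
    exact ⟨fun v => y (D.idxOf v), fun v => hy _, by rwa [← h.exc_reduce hl]⟩
  · rintro ⟨x, hx, hk⟩
    -- Variables outside `D` receive an arbitrary value through the round trip, which is harmless
    -- because the excess does not depend on them.
    refine ⟨fun i => x (D.getD i 0), fun i => hx _, hk.trans_eq ?_⟩
    rw [h.exc_reduce hl]
    refine exc_congr hl fun e he h0 v hv => ?_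
    have := List.idxOf_lt_length_of_mem (h.mem e he h0 v hv)
    simp [this]

/-- The representatives have distinct variable sets, all of them subsets of `D`. -/
theorem IsReduction.length_le (h : IsReduction l R D) : R.length ≤ 2 ^ D.length := by
  rw [← List.length_map (f := FlatEq.varSet), ← List.toFinset_card_of_nodup h.nodup]
  refine (Finset.card_le_card (t := D.toFinset.powerset) fun T hT => ?_).trans ?_
  · obtain ⟨e, he, rfl⟩ : ∃ e ∈ R, e.varSet = T := by simpa using hT
    refine Finset.mem_powerset.2 fun v hv => ?_
    simpa using h.mem e (h.subset e he) (h.ne_zero e he) v (by simpa [FlatEq.varSet] using hv)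
  · rw [Finset.card_powerset]
    exact Nat.pow_le_pow_right (by norm_num) (List.toFinset_card_le _)

end reduce

/-! ### Flat form of a system -/

/-- The flat form of an equation. -/
def WeightedEq.flat {r n : ℕ} (e : WeightedEq r n) : FlatEq where
  vars := (e.S.sort (· ≤ ·)).map fun i : Fin n => (i : ℕ)
  b := e.b.val
  w := e.w

theorem WeightedEq.valid_flat {r n : ℕ} (e : WeightedEq r n) : e.flat.Valid r n where
  sorted := by
    have := Finset.sortedLT_sort e.S
    exact List.pairwise_map.2 (this.pairwise.imp fun h => h)
  lt v hv := by
    obtain ⟨i, -, rfl⟩ := List.mem_map.1 hv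
    exact i.2
  ne_nil h := by
    have := congrArg List.length h
    simp [flat] at this
    exact e.nonempty.ne_empty this
  length_le := by simpa [flat] using e.card_le
  b_lt := ZMod.val_lt e.b
  w_pos := e.w_pos

/-- Needed to read the numbers written by the program as an actual instance of the problem. -/
theorem FlatEq.Valid.exists_flat {r n : ℕ} {e : FlatEq} (h : e.Valid r n) :
    ∃ e' : WeightedEq r n, e'.flat = e := by
  have hS : (((Finset.univ.filter fun i : Fin n => (i : ℕ) ∈ e.vars).sort (· ≤ ·)).map
      fun i : Fin n => (i : ℕ)) = e.vars := by
    refine List.Perm.eq_of_pairwise (le := (· < ·)) (fun a b _ _ h h' => absurd h' h.asymm) ?_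
      h.sorted ?_
    · exact List.pairwise_map.2 ((Finset.sortedLT_sort _).pairwise.imp fun h => h)
    · refine (List.perm_ext_iff_of_nodup
        ((Finset.sort_nodup _ _).map Fin.val_injective) h.nodup).2 fun v => ?_
      simp only [List.mem_map, Finset.mem_sort, Finset.mem_filter, Finset.mem_univ, true_and]
      exact ⟨by rintro ⟨i, hi, rfl⟩; exact hi, fun hv => ⟨⟨v, h.lt v hv⟩, hv, rfl⟩⟩
  have hcard : (Finset.univ.filter fun i : Fin n => (i : ℕ) ∈ e.vars).card = e.vars.length := by
    rw [← Finset.length_sort (· ≤ ·), ← List.length_map (f := fun i : Fin n => (i : ℕ)), hS]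
  refine ⟨⟨Finset.univ.filter fun i : Fin n => (i : ℕ) ∈ e.vars, e.b, e.w, ?_, ?_, h.w_pos⟩, ?_⟩
  · rw [← Finset.card_pos, hcard]
    exact List.length_pos_iff.2 h.ne_nil
  · rw [hcard]
    exact h.length_le
  · have hb : ((e.b : ZMod 2)).val = e.b := ZMod.val_cast_of_lt h.b_lt
    simp only [WeightedEq.flat, hS, hb]

theorem exists_map_flat {r n : ℕ} {es : List FlatEq} (h : ∀ e ∈ es, e.Valid r n) :
    ∃ es' : List (WeightedEq r n), es'.map WeightedEq.flat = es := by
  induction es with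
  | nil => exact ⟨[], rfl⟩
  | cons e es ih =>
    obtain ⟨e', he'⟩ := (h e List.mem_cons_self).exists_flat
    obtain ⟨es', hes'⟩ := ih fun e he => h e (List.mem_cons_of_mem _ he)
    exact ⟨e' :: es', by rw [List.map_cons, he', hes']⟩

namespace RLinSystem

variable {r : ℕ} (I : RLinSystem r)

/-- The flat form of a system. -/
def flat : List FlatEq := I.eqs.map WeightedEq.flat

theorem length_flat : I.flat.length = I.m := by simp [flat, m]

theorem valid_flat : ∀ e ∈ I.flat, e.Valid r I.n := by
  intro e he
  obtain ⟨e, -, rfl⟩ := List.mem_map.1 he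
  exact e.valid_flat

theorem encode_eq : I.encode = I.n :: I.flat.length :: I.flat.flatMap FlatEq.enc := by
  simp [encode, flat, m, List.flatMap_map, FlatEq.enc, WeightedEq.flat]
  simp [List.map_eq_flatMap]

end RLinSystem

/-- The map from 𝔽₂ to signs is multiplicative, so the product of the signs is the sign of the
left-hand side; it agrees with the sign of `b` exactly when the equation holds. -/
theorem WeightedEq.sw_mul_prod {r n : ℕ} (e : WeightedEq r n) (z : Fin n → ZMod 2) :
    e.flat.sw * (e.flat.vars.map (signs z)).prod = if e.Sat z then (e.w : ℤ) else -e.w := by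
  have h1 : (e.flat.vars.map (signs z)).prod = ∏ i ∈ e.S, if z i = 0 then (1 : ℤ) else -1 := by
    rw [flat, List.map_map, ← List.prod_toFinset _ (Finset.sort_nodup _ _), Finset.sort_toFinset]
    exact Finset.prod_congr rfl fun i _ => by simp [signs]
  have h2 (S : Finset (Fin n)) : (∏ i ∈ S, if z i = 0 then (1 : ℤ) else -1) =
      if ∑ i ∈ S, z i = 0 then 1 else -1 := by
    induction S using Finset.induction_on with
    | empty => simp
    | insert a S ha ih =>
      rw [Finset.prod_insert ha, Finset.sum_insert ha, ih]
      generalize z a = p, ∑ i ∈ S, z i = q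
      revert p q
      decide
  rw [h1, h2]
  simp only [FlatEq.sw, flat, ZMod.val_eq_zero]
  have : ∀ p q : ZMod 2, (p = q ↔ (p = 0 ↔ q = 0)) := by decide
  have hsat : e.Sat z ↔ (∑ i ∈ e.S, z i = 0 ↔ e.b = 0) := this _ _
  simp only [hsat]
  by_cases hp : ∑ i ∈ e.S, z i = 0 <;> by_cases hq : e.b = 0 <;> simp [hp, hq]

theorem RLinSystem.excess_eq {r : ℕ} (I : RLinSystem r) (z : Fin I.n → ZMod 2) :
    I.excess z = exc I.flat (signs z) := by
  obtain ⟨n, eqs⟩ := I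
  simp only [excess, flat, exc, List.map_map]
  induction eqs with
  | nil => simp
  | cons e eqs ih =>
    have := e.sw_mul_prod z
    simp only [List.map_cons, List.sum_cons, Function.comp_apply] at ih ⊢
    rw [← ih, this]
    by_cases h : e.Sat z
    · simp [h]
      ring
    · simp [h]
      ring

/-- Quantifying over sign functions on all of `ℕ` removes the dependence on the number of variables,
which differs between an instance and its kernel. -/
theorem maxRLinAA_yes_iff {r : ℕ} (I : RLinSystem r) (k : ℕ) :
    (maxRLinAA r).Yes I k ↔ ∃ x, IsSign x ∧ (k : ℤ) ≤ exc I.flat x := by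
  have : (maxRLinAA r).Yes I k ↔ ∃ z, (k : ℤ) ≤ I.excess z := by
    change (k : ℤ) ≤ I.maxExcess ↔ _
    exact Finset.le_sup'_iff _ |>.trans (by simp only [Finset.mem_univ, true_and])
  rw [this]
  constructor
  · rintro ⟨z, hz⟩
    exact ⟨signs z, isSign_signs z, by rwa [← I.excess_eq]⟩
  · rintro ⟨x, hx, hk⟩
    refine ⟨fun i => if x i = 1 then 0 else 1, ?_⟩
    rw [I.excess_eq]
    refine hk.trans_eq (exc_congr (fun e he => (I.valid_flat e he).nodup) fun e he _ v hv => ?_)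
    have hvn := (I.valid_flat e he).lt v hv
    rcases hx v with h | h <;> simp [signs, hvn, h]

/-! ### Labels of variables -/

/-- Append `v` to the list unless it is there. -/
def addNew (D : List ℕ) (v : ℕ) : List ℕ := if v ∈ D then D else D ++ [v]

/-- The distinct elements of a list, in the order of their first occurrences. -/
def firstOccs (L : List ℕ) : List ℕ := L.foldl addNew []

theorem firstOccs_concat (L : List ℕ) (v : ℕ) : firstOccs (L ++ [v]) = addNew (firstOccs L) v := by
  simp [firstOccs]

theorem mem_firstOccs {L : List ℕ} {v : ℕ} : v ∈ firstOccs L ↔ v ∈ L := by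
  induction L using List.reverseRecOn generalizing v with
  | nil => simp [firstOccs]
  | append_singleton L a ih =>
    rw [firstOccs_concat, addNew]
    split_ifs with h
    · rw [ih, List.mem_append, List.mem_singleton, iff_self_or]
      rintro rfl
      exact ih.1 h
    · simp [ih]

theorem nodup_firstOccs (L : List ℕ) : (firstOccs L).Nodup := by
  induction L using List.reverseRecOn with
  | nil => simp [firstOccs]
  | append_singleton L a ih =>
    rw [firstOccs_concat, addNew]
    split_ifs with h
    · exact ih
    · exact List.nodup_append.2 ⟨ih, by simp, by
        rintro b hb _ hc rfl
        exact h (List.mem_singleton.1 hc ▸ hb)⟩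

theorem length_firstOccs_le (L : List ℕ) : (firstOccs L).length ≤ L.length :=
  ((nodup_firstOccs L).subperm fun _ h => mem_firstOccs.1 h).length_le

/-- The label of a variable: its position in `D`, starting with `1`, and `0` if it is not there. -/
def label (D : List ℕ) (v : ℕ) : ℕ := if v ∈ D then D.idxOf v + 1 else 0

theorem label_nil : label [] = 0 := by
  ext v
  simp [label]

theorem label_le (D : List ℕ) (v : ℕ) : label D v ≤ D.length := by
  unfold label
  split_ifs with h
  · exact List.idxOf_lt_length_of_mem h
  · exact Nat.zero_le _

theorem label_inj {D : List ℕ} {v v' : ℕ} (hv : v ∈ D) (hv' : v' ∈ D)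
    (h : label D v = label D v') : v = v' := by
  simp only [label, hv, hv', if_true, add_left_inj] at h
  exact (List.idxOf_inj hv).1 h

theorem label_append {D : List ℕ} {v : ℕ} (h : v ∉ D) :
    label (D ++ [v]) = Function.update (label D) v (D.length + 1) := by
  ext a
  by_cases ha : a = v
  · subst ha
    simp [label, List.idxOf_append, h]
  · by_cases haD : a ∈ D <;> simp [label, List.idxOf_append, ha, haD]

/-- Give the variable in register `5` a label in the bank `lab`, unless it has one; the register
`N` holds the number of labels. -/
def registerVar (lab N : ℕ) : RAMProg :=
  .cond (.get lab (.reg 5)) .skip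
    (setReg N (.add (.reg N) (.const 1)) ;; .assign lab (.reg 5) (.reg N))

/-- Labels start at `1` because fresh memory is `0`: the bank is then literally the function `label
D`, and membership in `D` is a single lookup. -/
theorem runs_registerVar {B lab N : ℕ} {s : RAMState} {D : List ℕ} (h₁ : lab ≠ N) (h₂ : N ≠ 5)
    (hD : s lab = label D) (hN : s N 0 = D.length) :
    Runs B (registerVar lab N) s fun s' =>
      s' lab = label (addNew D (s 5 0)) ∧ s' N 0 = (addNew D (s 5 0)).length := by
  refine .cond (fun h => .skip ?_) fun h => .seq (.assign (.assign ?_))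
  · have : s 5 0 ∈ D := by
      by_contra hv
      simp [RAMExpr.eval, hD, label, hv] at h
    simp [addNew, this, hD, hN]
  · have : s 5 0 ∉ D := by
      intro hv
      simp [RAMExpr.eval, hD, label, hv] at h
    simp [RAMExpr.eval, addNew, this, hD, hN, label_append, h₁, h₁.symm, h₂.symm]

/-! ### Keys of variable sets -/

/-- The sum of the powers of two whose exponents are the labels of the variables. -/
def keyOf (D : List ℕ) (e : FlatEq) : ℕ := (e.vars.map fun v => 2 ^ label D v).sum

/-- Distinct variables have distinct labels, so a key is the binary expansion of the label set. Used
as an address, it finds the class of an equation without a search. -/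
theorem keyOf_eq_iff {D : List ℕ} {e e' : FlatEq} (he : e.vars.Nodup) (he' : e'.vars.Nodup)
    (hD : ∀ v ∈ e.vars, v ∈ D) (hD' : ∀ v ∈ e'.vars, v ∈ D) :
    keyOf D e = keyOf D e' ↔ e.varSet = e'.varSet := by
  have key {e : FlatEq} (he : e.vars.Nodup) (hD : ∀ v ∈ e.vars, v ∈ D) :
      keyOf D e = ∑ i ∈ e.varSet.image (label D), 2 ^ i := by
    rw [Finset.sum_image, FlatEq.varSet, List.sum_toFinset _ he, keyOf]
    intro v hv v' hv' h
    exact label_inj (hD v (by simpa [FlatEq.varSet] using hv))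
      (hD v' (by simpa [FlatEq.varSet] using hv')) h
  have sub {e e' : FlatEq} (hD : ∀ v ∈ e.vars, v ∈ D) (hD' : ∀ v ∈ e'.vars, v ∈ D)
      (h : e.varSet.image (label D) = e'.varSet.image (label D)) : e.varSet ⊆ e'.varSet := by
    intro v hv
    have : label D v ∈ e'.varSet.image (label D) := h ▸ Finset.mem_image_of_mem _ hv
    obtain ⟨v', hv', hvv⟩ := Finset.mem_image.1 this
    rwa [label_inj (hD v (by simpa [FlatEq.varSet] using hv))
      (hD' v' (by simpa [FlatEq.varSet] using hv')) hvv.symm]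
  rw [key he hD, key he' hD']
  constructor
  · intro h
    have := Finset.geomSum_injective (n := 2) le_rfl h
    exact (sub hD hD' this).antisymm (sub hD' hD this.symm)
  · intro h
    rw [h]

/-- Total weight of the equations with value `a` under `φ` whose right-hand side satisfies `p`. -/
def weightOf (φ : FlatEq → ℕ) (p : ℕ → Bool) (l : List FlatEq) (a : ℕ) : ℕ :=
  ((l.filter fun e => φ e = a && p e.b).map FlatEq.w).sum

theorem weightOf_concat (φ : FlatEq → ℕ) (p : ℕ → Bool) (l : List FlatEq) (e : FlatEq) :
    weightOf φ p (l ++ [e]) = if p e.b then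
      Function.update (weightOf φ p l) (φ e) (weightOf φ p l (φ e) + e.w) else weightOf φ p l := by
  ext a
  by_cases hp : p e.b
  · by_cases ha : a = φ e
    · subst ha
      simp [weightOf, hp]
    · simp [weightOf, hp, ha, Ne.symm ha]
  · simp [weightOf, hp]

/-- The machine has only natural numbers, so the positive and negative parts of a coefficient are
accumulated separately. -/
theorem weightOf_sub_weightOf (φ : FlatEq → ℕ) (l : List FlatEq) (a : ℕ) :
    (weightOf φ (· == 0) l a : ℤ) - weightOf φ (· != 0) l a = coef φ l a := by
  induction l with
  | nil => simp [weightOf, coef]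
  | cons e l ih =>
    rw [coef_cons, ← ih]
    by_cases ha : φ e = a <;> by_cases hb : e.b = 0 <;> simp [weightOf, FlatEq.sw, ha, hb] <;> ring

/-! ### Analysis of the input -/

/-- The memory bank holds the parameter and the equations, and `B` bounds their number and the
number of occurrences of variables. -/
structure Loaded (B k : ℕ) (eqs : List FlatEq) (mem : ℕ → ℕ) : Prop where
  param : mem 1 = k
  count : mem 3 = eqs.length
  holds : Holds mem 4 (eqs.flatMap FlatEq.enc)
  length_le : eqs.length ≤ B
  occs_le : (eqs.flatMap FlatEq.vars).length ≤ B

theorem Loaded.vars_length_le {B k : ℕ} {eqs : List FlatEq} {mem : ℕ → ℕ}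
    (h : Loaded B k eqs mem) {e : FlatEq} (he : e ∈ eqs) : e.vars.length ≤ B := by
  refine le_trans ?_ h.occs_le
  rw [List.length_flatMap]
  exact List.single_le_sum (by simp) _ (List.mem_map_of_mem he)

/-- The right-hand side of the current equation. -/
def rhsExpr : RAMExpr := .get 0 (.add (.add (.reg 2) (.get 0 (.reg 2))) (.const 1))

/-- The weight of the current equation. -/
def weightExpr : RAMExpr := .get 0 (.add (.add (.reg 2) (.get 0 (.reg 2))) (.const 2))

section Current

variable {s : RAMState} {e : FlatEq}

theorem eval_lengthExpr (h : Holds (s 0) (s 2 0) e.enc) : s 0 (s 2 0) = e.vars.length := by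
  rw [FlatEq.enc, List.cons_append, holds_cons] at h
  exact h.1

theorem eval_rhsExpr (h : Holds (s 0) (s 2 0) e.enc) : rhsExpr.eval s = e.b := by
  have h' := h
  rw [FlatEq.enc, List.cons_append, holds_cons, holds_append, holds_cons] at h
  simp only [rhsExpr, RAMExpr.eval, eval_lengthExpr h']
  rw [← h.2.2.1]
  congr 1
  omega

theorem eval_weightExpr (h : Holds (s 0) (s 2 0) e.enc) : weightExpr.eval s = e.w := by
  have h' := h
  rw [FlatEq.enc, List.cons_append, holds_cons, holds_append, holds_cons, holds_cons] at h
  simp only [weightExpr, RAMExpr.eval, eval_lengthExpr h']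
  rw [← h.2.2.2.1]
  congr 1
  omega

end Current

/-- Bank `6` gets the labels of all variables, and register `7` their number. -/
def labelPass : RAMProg := eqLoop (varLoop (registerVar 6 7))

theorem runs_labelPass {B k : ℕ} {eqs : List FlatEq} {s : RAMState} (h : Loaded B k eqs (s 0))
    (h6 : s 6 = 0) (h7 : s 7 0 = 0) : Runs B labelPass s fun s' =>
      s' 6 = label (firstOccs (eqs.flatMap FlatEq.vars)) ∧
      s' 7 0 = (firstOccs (eqs.flatMap FlatEq.vars)).length := by
  refine Runs.eqLoop (fun l s => s 6 = label (firstOccs (l.flatMap FlatEq.vars)) ∧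
    s 7 0 = (firstOccs (l.flatMap FlatEq.vars)).length) h.length_le h.count h.holds rfl rfl rfl
    (fun l s v h => by simpa using h) (fun l s v h => by simpa using h)
    ⟨by simpa [firstOccs, label_nil] using h6, by simpa [firstOccs] using h7⟩ ?_
  rintro l e l' s hl hf hH ⟨hI6, hI7⟩
  have := Runs.varLoop (B := B) (P := registerVar 6 7) (s₀ := s) (e := e) (fun vs s =>
    s 6 = label (firstOccs (l.flatMap FlatEq.vars ++ vs)) ∧
    s 7 0 = (firstOccs (l.flatMap FlatEq.vars ++ vs)).length) (h.vars_length_le (by simp [hl])) hH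
    rfl rfl rfl (fun l s v h => by simpa using h) (fun l s v h => by simpa using h)
    (by simpa using ⟨hI6, hI7⟩) ?_
  · simpa using this
  · rintro vs v vs' s hv hf' h5 ⟨hJ6, hJ7⟩
    refine (runs_registerVar (by decide) (by decide) hJ6 hJ7).mono fun s' _ hreg => ?_
    rwa [h5, ← firstOccs_concat, List.append_assoc] at hreg

/-- Bank `8` gets the powers of two up to the number of labels in register `7`. -/
def powPass : RAMProg :=
  .assign 8 (.const 0) (.const 1) ;; forTo 9 (.reg 7) (.assign 8 (.add (.reg 9) (.const 1))
    (.add (.get 8 (.reg 9)) (.get 8 (.reg 9))))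

theorem runs_powPass {B n : ℕ} {s : RAMState} (hn : n ≤ B) (h7 : s 7 0 = n) :
    Runs B powPass s fun s' => ∀ i ≤ n, s' 8 i = 2 ^ i := by
  refine .seq (.assign ?_)
  refine Runs.forTo (fun j s => ∀ i ≤ j, s 8 i = 2 ^ i) hn rfl ?_
    (fun j s v h => by simpa using h) ?_ ?_
  · intro s' hf
    simp only [RAMExpr.eval]
    rw [hf 7 rfl]
    simpa [RAMExpr.eval] using h7
  · simp [RAMExpr.eval]
  · intro j s' hj hf h9 hI
    refine .assign fun i hi => ?_
    rcases Nat.lt_or_eq_of_le hi with hi | rfl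
    · have : i ≠ j + 1 := by omega
      simpa [RAMExpr.eval, h9, this] using hI i (by omega)
    · simp [RAMExpr.eval, h9, hI j le_rfl]
      ring

/-- Register `10` gets the key of the current equation. -/
def keyProg : RAMProg :=
  setReg 10 (.const 0) ;; varLoop (setReg 10 (.add (.reg 10) (.get 8 (.get 6 (.reg 5)))))

theorem runs_keyProg {B : ℕ} {s : RAMState} {e : FlatEq} {D : List ℕ} (hB : e.vars.length ≤ B)
    (hH : Holds (s 0) (s 2 0) e.enc) (h6 : s 6 = label D) (h8 : ∀ i ≤ D.length, s 8 i = 2 ^ i) :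
    Runs B keyProg s fun s' => s' 10 0 = keyOf D e := by
  refine .seq (.assign ?_)
  refine Runs.varLoop (fun vs s => s 10 0 = (vs.map fun v => 2 ^ label D v).sum) hB
    (by simpa [RAMExpr.eval] using hH) rfl rfl rfl (fun l s v h => by simpa using h)
    (fun l s v h => by simpa using h) (by simp [RAMExpr.eval]) ?_
  intro vs v vs' s' hv hf h5 hI
  refine .assign ?_
  have e6 : s' 6 = label D := by rw [hf 6 rfl]; simpa using h6
  have e8 : s' 8 = s 8 := by rw [hf 8 rfl]; simp
  simp [RAMExpr.eval, h5, hI, e6, e8, h8 _ (label_le D v)]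

/-- Banks `11` and `12` get the total weights of the equations with right-hand side `0` and `1`,
at the addresses given by the keys. -/
def weightPass : RAMProg :=
  eqLoop (keyProg ;; .cond rhsExpr
    (.assign 12 (.reg 10) (.add (.get 12 (.reg 10)) weightExpr))
    (.assign 11 (.reg 10) (.add (.get 11 (.reg 10)) weightExpr)))

theorem runs_weightPass {B k : ℕ} {eqs : List FlatEq} {s : RAMState} {D : List ℕ}
    (h : Loaded B k eqs (s 0)) (h6 : s 6 = label D) (h8 : ∀ i ≤ D.length, s 8 i = 2 ^ i)
    (h11 : s 11 = 0) (h12 : s 12 = 0) : Runs B weightPass s fun s' =>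
      s' 11 = weightOf (keyOf D) (· == 0) eqs ∧ s' 12 = weightOf (keyOf D) (· != 0) eqs := by
  refine Runs.eqLoop (fun l s => s 11 = weightOf (keyOf D) (· == 0) l ∧
    s 12 = weightOf (keyOf D) (· != 0) l) h.length_le h.count h.holds rfl rfl rfl
    (fun l s v h => by simpa using h) (fun l s v h => by simpa using h)
    ⟨by rw [h11]; rfl, by rw [h12]; rfl⟩ ?_
  rintro l e l' s' hl hf hH ⟨hI11, hI12⟩
  refine .seq ((runs_keyProg (h.vars_length_le (by simp [hl])) hH ((hf 6 rfl).trans h6)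
    ((hf 8 rfl).symm ▸ h8)).mono fun s'' hf' h10 => ?_)
  have hH' : Holds (s'' 0) (s'' 2 0) e.enc := by rwa [hf' 0 rfl, hf' 2 rfl]
  rw [← hf' 11 rfl] at hI11
  rw [← hf' 12 rfl] at hI12
  refine .cond (fun hb => .assign ?_) fun hb => .assign ?_
  · rw [eval_rhsExpr hH'] at hb
    simp [RAMExpr.eval, eval_weightExpr hH', weightOf_concat, hb, h10, hI11, hI12]
  · rw [eval_rhsExpr hH'] at hb
    simp [RAMExpr.eval, eval_weightExpr hH', weightOf_concat, hb, h10, hI11, hI12]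

/-- The total signed weight of the equations with the variables of `e`. -/
abbrev netWeight (eqs : List FlatEq) (e : FlatEq) : ℤ := coef FlatEq.varSet eqs e.varSet

/-- The absolute value of the total signed weight for the key in register `10`. -/
def absExpr : RAMExpr :=
  .add (.sub (.get 11 (.reg 10)) (.get 12 (.reg 10))) (.sub (.get 12 (.reg 10)) (.get 11 (.reg 10)))

/-- The tables of labels, powers of two and weights are set up. -/
structure Tables (eqs : List FlatEq) (s : RAMState) : Prop where
  labels : s 6 = label (firstOccs (eqs.flatMap FlatEq.vars))
  pows : ∀ i ≤ (firstOccs (eqs.flatMap FlatEq.vars)).length, s 8 i = 2 ^ i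
  pos : s 11 = weightOf (keyOf (firstOccs (eqs.flatMap FlatEq.vars))) (· == 0) eqs
  neg : s 12 = weightOf (keyOf (firstOccs (eqs.flatMap FlatEq.vars))) (· != 0) eqs

/-- The key of an equation with respect to the labels of all variables. -/
abbrev keyIn (eqs : List FlatEq) (e : FlatEq) : ℕ := keyOf (firstOccs (eqs.flatMap FlatEq.vars)) e

theorem mem_occs {eqs : List FlatEq} {e : FlatEq} (he : e ∈ eqs) :
    ∀ v ∈ e.vars, v ∈ firstOccs (eqs.flatMap FlatEq.vars) :=
  fun _ hv => mem_firstOccs.2 (List.mem_flatMap.2 ⟨e, he, hv⟩)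

theorem keyIn_eq_iff {eqs : List FlatEq} (hl : ∀ e ∈ eqs, e.vars.Nodup) {e e' : FlatEq}
    (he : e ∈ eqs) (he' : e' ∈ eqs) : keyIn eqs e = keyIn eqs e' ↔ e.varSet = e'.varSet :=
  keyOf_eq_iff (hl e he) (hl e' he') (mem_occs he) (mem_occs he')

namespace Tables

variable {eqs : List FlatEq} {s s' : RAMState} {e : FlatEq}

theorem congr (h : Tables eqs s) (h6 : s' 6 = s 6) (h8 : s' 8 = s 8) (h11 : s' 11 = s 11)
    (h12 : s' 12 = s 12) : Tables eqs s' :=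
  ⟨h6 ▸ h.labels, h8 ▸ h.pows, h11 ▸ h.pos, h12 ▸ h.neg⟩

theorem sub_eq (h : Tables eqs s) (hl : ∀ e ∈ eqs, e.vars.Nodup) (he : e ∈ eqs) :
    (s 11 (keyIn eqs e) : ℤ) - s 12 (keyIn eqs e) = netWeight eqs e := by
  rw [h.pos, h.neg, weightOf_sub_weightOf]
  exact coef_congr fun e' he' => keyIn_eq_iff hl he' he

/-- One of the two truncated differences is `0` and the other is the absolute value. -/
theorem eval_absExpr (h : Tables eqs s) (hl : ∀ e ∈ eqs, e.vars.Nodup) (he : e ∈ eqs)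
    (h10 : s 10 0 = keyIn eqs e) : absExpr.eval s = (netWeight eqs e).natAbs := by
  rw [← h.sub_eq hl he]
  simp only [absExpr, RAMExpr.eval, h10]
  omega

theorem runs_keyProg {B : ℕ} (h : Tables eqs s) (hB : e.vars.length ≤ B)
    (hH : Holds (s 0) (s 2 0) e.enc) :
    Runs B keyProg s fun s' => s' 10 0 = keyIn eqs e ∧ Tables eqs s' ∧
      Holds (s' 0) (s' 2 0) e.enc := by
  refine (_root_.runs_keyProg hB hH h.labels h.pows).mono fun s' hf h10 => ⟨h10, ?_, ?_⟩
  · exact h.congr (hf 6 rfl) (hf 8 rfl) (hf 11 rfl) (hf 12 rfl)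
  · rwa [hf 0 rfl, hf 2 rfl]

end Tables

/-- The variables of the equations with nonzero total signed weight. -/
def essentialVars (eqs l : List FlatEq) : List ℕ :=
  firstOccs ((l.filter fun e => netWeight eqs e ≠ 0).flatMap FlatEq.vars)

/-- Bank `13` gets the labels of the variables of equations with nonzero total signed weight, and
register `14` their number; register `19` becomes nonzero if the parameter is at most the absolute
value of some total signed weight. -/
def essentialPass : RAMProg :=
  eqLoop (keyProg ;; (.cond absExpr (varLoop (registerVar 13 14)) .skip) ;;
    .cond (.sub (.add absExpr (.const 1)) (.get 0 (.const 1))) (setReg 19 (.const 1)) .skip)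

theorem runs_essentialPass {B k : ℕ} {eqs : List FlatEq} {s : RAMState}
    (h : Loaded B k eqs (s 0)) (hl : ∀ e ∈ eqs, e.vars.Nodup) (ht : Tables eqs s)
    (h13 : s 13 = 0) (h14 : s 14 0 = 0) (h19 : s 19 0 = 0) : Runs B essentialPass s fun s' =>
      s' 13 = label (essentialVars eqs eqs) ∧ s' 14 0 = (essentialVars eqs eqs).length ∧
      (s' 19 0 = 0 ↔ ∀ e ∈ eqs, (netWeight eqs e).natAbs < k) := by
  refine Runs.eqLoop (fun l s => s 13 = label (essentialVars eqs l) ∧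
    s 14 0 = (essentialVars eqs l).length ∧
    (s 19 0 = 0 ↔ ∀ e ∈ l, (netWeight eqs e).natAbs < k)) h.length_le h.count h.holds rfl rfl rfl
    (fun l s v h => by simpa using h) (fun l s v h => by simpa using h)
    ⟨by rw [h13, essentialVars]; simp [firstOccs, label_nil],
      by simp [h14, essentialVars, firstOccs],
      by simp [h19]⟩ ?_
  rintro l e l' s₁ hel hf hH ⟨hI13, hI14, hI19⟩
  have he : e ∈ eqs := by simp [hel]
  have ht₁ : Tables eqs s₁ := ht.congr (hf 6 rfl) (hf 8 rfl) (hf 11 rfl) (hf 12 rfl)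
  refine .seq ((ht₁.runs_keyProg (h.vars_length_le he) hH).mono ?_)
  rintro s₂ hf₂ ⟨h10, ht₂, hH₂⟩
  rw [← hf₂ 13 rfl] at hI13
  rw [← hf₂ 14 rfl] at hI14
  rw [← hf₂ 19 rfl] at hI19
  have step : Runs B (.cond absExpr (varLoop (registerVar 13 14)) .skip) s₂ fun s' =>
      s' 13 = label (essentialVars eqs (l ++ [e])) ∧
      s' 14 0 = (essentialVars eqs (l ++ [e])).length := by
    refine .cond (fun h0 => ?_) fun h0 => .skip ?_
    · rw [ht₂.eval_absExpr hl he h10, Int.natAbs_ne_zero] at h0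
      have := Runs.varLoop (B := B) (P := registerVar 13 14) (s₀ := s₂) (e := e) (fun vs s =>
        s 13 = label (firstOccs
          ((l.filter fun e => netWeight eqs e ≠ 0).flatMap FlatEq.vars ++ vs)) ∧
        s 14 0 = (firstOccs
          ((l.filter fun e => netWeight eqs e ≠ 0).flatMap FlatEq.vars ++ vs)).length)
        (h.vars_length_le he) hH₂
        rfl rfl rfl (fun l s v h => by simpa using h) (fun l s v h => by simpa using h)
        (by have := And.intro hI13 hI14; simpa [essentialVars] using this) ?_
      · simpa [essentialVars, h0] using this
      · rintro vs v vs' s hv hf' h5 ⟨hJ6, hJ7⟩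
        refine (runs_registerVar (by decide) (by decide) hJ6 hJ7).mono fun s' _ h' => ?_
        rwa [h5, ← firstOccs_concat, List.append_assoc] at h'
    · rw [ht₂.eval_absExpr hl he h10, Int.natAbs_eq_zero] at h0
      have := And.intro hI13 hI14
      simpa [essentialVars, h0] using this
  refine .seq (step.mono ?_)
  rintro s₃ hf₃ ⟨hJ13, hJ14⟩
  have ht₃ : Tables eqs s₃ := ht₂.congr (hf₃ 6 rfl) (hf₃ 8 rfl) (hf₃ 11 rfl) (hf₃ 12 rfl)
  have h10' : s₃ 10 0 = keyIn eqs e := by rw [hf₃ 10 rfl, h10]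
  rw [← hf₃ 19 rfl] at hI19
  have hk : s₃ 0 1 = k := by rw [hf₃ 0 rfl, hf₂ 0 rfl, hf 0 rfl, h.param]
  -- With truncated subtraction, `a + 1 - k ≠ 0` is the test `k ≤ a`.
  have hev : (RAMExpr.sub (.add absExpr (.const 1)) (.get 0 (.const 1))).eval s₃ =
      (netWeight eqs e).natAbs + 1 - k := by
    simp [RAMExpr.eval, ht₃.eval_absExpr hl he h10', hk]
  refine .cond (fun h0 => .assign ?_) fun h0 => .skip ?_
  · refine ⟨by simpa using hJ13, by simpa using hJ14, ?_⟩
    rw [hev] at h0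
    simp only [RAMExpr.eval, RAMState.write_self, Function.update_self, one_ne_zero, false_iff]
    intro hall
    have := hall e (by simp)
    omega
  · refine ⟨hJ13, hJ14, ?_⟩
    rw [hev] at h0
    rw [hI19]
    simp only [List.mem_append, List.mem_singleton, or_imp, forall_and, forall_eq]
    have : (netWeight eqs e).natAbs < k := by omega
    tauto

/-- The complete analysis of the input. -/
def analysis : RAMProg := labelPass ;; powPass ;; weightPass ;; essentialPass

/-- The result of the analysis. -/
structure Analyzed (k : ℕ) (eqs : List FlatEq) (s : RAMState) : Prop where
  tables : Tables eqs s
  labels : s 13 = label (essentialVars eqs eqs)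
  count : s 14 0 = (essentialVars eqs eqs).length
  flag : s 19 0 = 0 ↔ ∀ e ∈ eqs, (netWeight eqs e).natAbs < k

theorem runs_analysis {B k : ℕ} {eqs : List FlatEq} {s : RAMState} (h : Loaded B k eqs (s 0))
    (hl : ∀ e ∈ eqs, e.vars.Nodup) (h0 : ∀ b ≠ 0, s b = 0) :
    Runs B analysis s (Analyzed k eqs) := by
  have hD : (firstOccs (eqs.flatMap FlatEq.vars)).length ≤ B :=
    (length_firstOccs_le _).trans h.occs_le
  refine .seq ((runs_labelPass h (h0 6 (by decide)) (by simp [h0])).mono ?_)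
  rintro s₁ hf₁ ⟨h6, h7⟩
  refine .seq ((runs_powPass hD h7).mono ?_)
  intro s₂ hf₂ h8
  rw [← hf₂ 6 rfl] at h6
  have h₂ : Loaded B k eqs (s₂ 0) := by rwa [hf₂ 0 rfl, hf₁ 0 rfl]
  refine .seq ((runs_weightPass h₂ h6 h8 (by rw [hf₂ 11 rfl, hf₁ 11 rfl, h0 11 (by decide)])
    (by rw [hf₂ 12 rfl, hf₁ 12 rfl, h0 12 (by decide)])).mono ?_)
  rintro s₃ hf₃ ⟨h11, h12⟩
  have ht : Tables eqs s₃ := ⟨(hf₃ 6 rfl).trans h6, (hf₃ 8 rfl).symm ▸ h8, h11, h12⟩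
  have hz (b : ℕ) (hb : b ≠ 0) (e₁ : labelPass.writes b = false) (e₂ : powPass.writes b = false)
      (e₃ : weightPass.writes b = false) : s₃ b = 0 := by
    rw [hf₃ b e₃, hf₂ b e₂, hf₁ b e₁, h0 b hb]
  refine (runs_essentialPass (by rwa [hf₃ 0 rfl]) hl ht (hz 13 (by decide) rfl rfl rfl)
    (by rw [hz 14 (by decide) rfl rfl rfl]; rfl)
    (by rw [hz 19 (by decide) rfl rfl rfl]; rfl)).mono ?_
  rintro s₄ hf₄ ⟨h13, h14, h19⟩
  exact ⟨ht.congr (hf₄ 6 rfl) (hf₄ 8 rfl) (hf₄ 11 rfl) (hf₄ 12 rfl), h13, h14, h19⟩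

theorem mem_essentialVars {eqs : List FlatEq} {v : ℕ} :
    v ∈ essentialVars eqs eqs ↔ ∃ e ∈ eqs, netWeight eqs e ≠ 0 ∧ v ∈ e.vars := by
  simp [essentialVars, mem_firstOccs, and_assoc]

theorem length_essentialVars_le (eqs : List FlatEq) : (essentialVars eqs eqs).length ≤
    (firstOccs (eqs.flatMap FlatEq.vars)).length := by
  refine ((nodup_firstOccs _).subperm fun v hv => ?_).length_le
  obtain ⟨e, he, -, hv⟩ := mem_essentialVars.1 hv
  exact mem_occs he v hv

/-! ### Criteria for the answer yes, read off from the analysis. -/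

/-- A multiple of an expression. -/
def RAMExpr.smul : ℕ → RAMExpr → RAMExpr
  | 0, _ => .const 0
  | c + 1, e => .add (RAMExpr.smul c e) e

theorem RAMExpr.eval_smul (c : ℕ) (e : RAMExpr) (s : RAMState) :
    (RAMExpr.smul c e).eval s = c * e.eval s := by
  induction c with
  | zero => simp [RAMExpr.smul, RAMExpr.eval]
  | succ c ih => simp [RAMExpr.smul, RAMExpr.eval, ih, Nat.succ_mul]

/-- Nonzero if the analysis shows that the answer is yes. -/
def yesExpr (r : ℕ) : RAMExpr :=
  .add (.reg 19) (.sub (.add (.reg 14) (.const 1)) (.smul (2 * r) (.get 0 (.const 1))))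

theorem Analyzed.yesExpr_eq_zero_iff {k r : ℕ} {eqs : List FlatEq} {s : RAMState}
    (h : Analyzed k eqs s) (hk : s 0 1 = k) : (yesExpr r).eval s = 0 ↔
      (∀ e ∈ eqs, (netWeight eqs e).natAbs < k) ∧ (essentialVars eqs eqs).length < 2 * r * k := by
  rw [← h.flag]
  simp only [yesExpr, RAMExpr.eval, RAMExpr.eval_smul, h.count, hk]
  omega

theorem exists_le_exc_of_analysis {r n k : ℕ} {eqs : List FlatEq}
    (hl : ∀ e ∈ eqs, e.Valid r n) (hr : 0 < r)
    (h : ¬ ((∀ e ∈ eqs, (netWeight eqs e).natAbs < k) ∧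
      (essentialVars eqs eqs).length < 2 * r * k)) : ∃ x, IsSign x ∧ (k : ℤ) ≤ exc eqs x := by
  rw [not_and_or] at h
  rcases h with h | h
  · push Not at h
    obtain ⟨e, he, hk⟩ := h
    obtain ⟨x, hx, hle⟩ := exists_le_exc_of_coef hl he
    refine ⟨x, hx, le_trans ?_ hle⟩
    rw [Int.abs_eq_natAbs]
    exact_mod_cast hk
  · exact exists_le_exc_of_cover hl hr (nodup_firstOccs _) (fun v hv => mem_essentialVars.1 hv)
      (not_lt.1 h)

/-! ### Exhaustive search over the essential variables -/

theorem exc_concat (l : List FlatEq) (e : FlatEq) (x : ℕ → ℤ) :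
    exc (l ++ [e]) x = exc l x + e.sw * (e.vars.map x).prod := by
  simp [exc]

/-- Bank `20` gets the binary digits of the number in register `22`, as many as register `14` says,
starting at address `1`. -/
def digitsProg : RAMProg :=
  setReg 23 (.reg 22) ;; forTo 9 (.reg 14)
    (.cond (.sub (.add (.reg 23) (.const 1))
        (.get 8 (.sub (.reg 14) (.add (.reg 9) (.const 1)))))
      (.assign 20 (.sub (.reg 14) (.reg 9)) (.const 1) ;;
        setReg 23 (.sub (.reg 23) (.get 8 (.sub (.reg 14) (.add (.reg 9) (.const 1))))))
      (.assign 20 (.sub (.reg 14) (.reg 9)) (.const 0)))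

/-- Digits are extracted greedily from the top, with the table of powers of two replacing division.
Address `0` keeps the value `0`, so that variables without a label get the value `0`. -/
theorem runs_digitsProg {B N a : ℕ} {s : RAMState} (hB : N ≤ B) (h14 : s 14 0 = N)
    (h8 : ∀ i ≤ N, s 8 i = 2 ^ i) (h20 : s 20 0 = 0) (h22 : s 22 0 = a) (ha : a < 2 ^ N) :
    Runs B digitsProg s fun s' =>
      s' 20 0 = 0 ∧ ∀ d < N, s' 20 (d + 1) = (a.testBit d).toNat := by
  refine .seq (.assign ?_)
  refine (Runs.forTo (n := N) (fun j s => s 23 0 = a % 2 ^ (N - j) ∧ s 20 0 = 0 ∧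
    ∀ d < N, N - j ≤ d → s 20 (d + 1) = (a.testBit d).toNat) hB rfl ?_
    (fun j s v h => by simpa using h) ?_ ?_).mono ?_
  · intro s' hf
    simp only [RAMExpr.eval]
    rw [hf 14 rfl]
    simpa using h14
  · refine ⟨?_, by simpa using h20, fun d hd hd' => absurd hd' (by omega)⟩
    simp [RAMExpr.eval, h22, Nat.mod_eq_of_lt ha]
  · rintro j s' hj hf h9 ⟨h23, hz0, hz⟩
    have e14 : s' 14 0 = N := by rw [hf 14 rfl]; simpa using h14
    have e8 : s' 8 = s 8 := by rw [hf 8 rfl]; simp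
    obtain ⟨m, hm⟩ : ∃ m, N - j = m + 1 := ⟨N - j - 1, by omega⟩
    have hm' : N - (j + 1) = m := by omega
    have hlt : a % 2 ^ m < 2 ^ m := Nat.mod_lt _ (by positivity)
    -- The remainder modulo `2 ^ (m + 1)` is `2 ^ m` times the bit `m` plus a number below `2 ^ m`,
    -- so comparing it with `2 ^ m` reads that bit.
    rw [hm, Nat.mod_pow_succ, ← Nat.toNat_testBit] at h23
    have hnext (d : ℕ) (hd : d < N) (hd' : m ≤ d) (hne : d ≠ m) :
        s' 20 (d + 1) = (a.testBit d).toNat := hz d hd (by omega)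
    refine .cond (fun h => .seq (.assign (.assign ?_))) fun h => .assign ?_
    · have hbit : a.testBit m = true := by
        by_contra hb
        rw [Bool.not_eq_true] at hb
        simp only [RAMExpr.eval, e14, h9, hm', e8, h8 m (by omega), h23, hb] at h
        simp at h
        omega
      refine ⟨?_, ?_, fun d hd hd' => ?_⟩
      · simp [RAMExpr.eval, e14, h9, hm', e8, h8 m (by omega), h23, hbit]
      · simp [RAMExpr.eval, e14, h9, hm, hz0]
      · by_cases hne : d = m
        · subst hne
          simp [RAMExpr.eval, e14, h9, hm, hbit]
        · simpa [RAMExpr.eval, e14, h9, hm, hne] using hnext d hd (by omega) hne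
    · have hbit : a.testBit m = false := by
        by_contra hb
        simp only [Bool.not_eq_false] at hb
        simp only [RAMExpr.eval, e14, h9, hm', e8, h8 m (by omega), h23, hb] at h
        simp at h
        omega
      refine ⟨?_, ?_, fun d hd hd' => ?_⟩
      · simp [RAMExpr.eval, hm', h23, hbit]
      · simp [RAMExpr.eval, e14, h9, hm, hz0]
      · by_cases hne : d = m
        · subst hne
          simp [RAMExpr.eval, e14, h9, hm, hbit]
        · simpa [RAMExpr.eval, e14, h9, hm, hne] using hnext d hd (by omega) hne
  · rintro s' - ⟨-, h0, h⟩
    exact ⟨h0, fun d hd => h d hd (by omega)⟩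

/-- The absolute difference of two expressions. -/
def RAMExpr.dist (e₁ e₂ : RAMExpr) : RAMExpr := .add (.sub e₁ e₂) (.sub e₂ e₁)

/-- Registers `24` and `26` get the total weights of the equations that are satisfied and falsified
by the assignment whose values stand in bank `20`, at the labels in bank `13`. -/
def evalProg : RAMProg :=
  setReg 24 (.const 0) ;; setReg 26 (.const 0) ;; eqLoop
    (setReg 27 (.const 0) ;;
      varLoop (setReg 27 (.dist (.reg 27) (.get 20 (.get 13 (.reg 5))))) ;;
      .cond (.dist (.reg 27) rhsExpr) (setReg 26 (.add (.reg 26) weightExpr))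
        (setReg 24 (.add (.reg 24) weightExpr)))

theorem runs_evalProg {B k : ℕ} {eqs : List FlatEq} {s : RAMState} {x : ℕ → ℤ}
    (h : Loaded B k eqs (s 0)) (hb : ∀ e ∈ eqs, e.b < 2) (hx : IsSign x)
    (hz : ∀ v, s 20 (s 13 v) = if x v = 1 then 0 else 1) :
    Runs B evalProg s fun s' => (s' 24 0 : ℤ) - s' 26 0 = exc eqs x := by
  refine .seq (.assign (.seq (.assign ?_)))
  refine Runs.eqLoop (fun l s => (s 24 0 : ℤ) - s 26 0 = exc l x) h.length_le
    (by simpa using h.count) (by simpa using h.holds) rfl rfl rfl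
    (fun l s v h => by simpa using h) (fun l s v h => by simpa using h)
    (by simp [RAMExpr.eval, exc]) ?_
  intro l e l' s₁ hel hf hH hI
  have he : e ∈ eqs := by simp [hel]
  have hz₁ (v : ℕ) : s₁ 20 (s₁ 13 v) = if x v = 1 then 0 else 1 := by
    rw [hf 20 rfl, hf 13 rfl]
    simpa using hz v
  refine .seq (.assign (.seq ?_))
  -- Register `27` holds the parity of the values read so far: on `0` and `1`, the absolute
  -- difference is addition in 𝔽₂.
  refine (Runs.varLoop (e := e) (fun vs s => s 27 0 ≤ 1 ∧
    (vs.map x).prod = if s 27 0 = 0 then 1 else -1) (h.vars_length_le he)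
    (by simpa [RAMExpr.eval] using hH) rfl rfl rfl (fun l s v h => by simpa using h)
    (fun l s v h => by simpa using h) (by simp [RAMExpr.eval]) ?_).mono ?_
  · rintro vs v vs' s₂ hv hf₂ h5 ⟨hle, hprod⟩
    have hz₂ : s₂ 20 (s₂ 13 v) = if x v = 1 then 0 else 1 := by
      rw [hf₂ 20 rfl, hf₂ 13 rfl]
      simpa using hz₁ v
    refine .assign ?_
    simp only [RAMExpr.dist, RAMExpr.eval, h5, hz₂, RAMState.write_self, Function.update_self,
      List.map_append, List.prod_append, hprod, List.map_singleton, List.prod_singleton]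
    obtain h27 | h27 : s₂ 27 0 = 0 ∨ s₂ 27 0 = 1 := by omega
    all_goals rcases hx v with h | h <;> simp [h27, h]
  · rintro s₂ hf₂ ⟨hle, hprod⟩
    have hH₂ : Holds (s₂ 0) (s₂ 2 0) e.enc := by
      rw [hf₂ 0 rfl, hf₂ 2 rfl]
      simpa using hH
    have e24 : s₂ 24 = s₁ 24 := by rw [hf₂ 24 rfl]; simp
    have e26 : s₂ 26 = s₁ 26 := by rw [hf₂ 26 rfl]; simp
    have hbe := hb e he
    refine .cond (fun h0 => .assign ?_) fun h0 => .assign ?_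
    all_goals
      simp only [RAMExpr.dist, RAMExpr.eval, eval_rhsExpr hH₂] at h0
      simp only [exc_concat, ← hI, hprod, FlatEq.sw]
    · have : (s₂ 27 0 = 0 ∧ e.b ≠ 0) ∨ (s₂ 27 0 ≠ 0 ∧ e.b = 0) := by omega
      rcases this with ⟨h1, h2⟩ | ⟨h1, h2⟩ <;>
        simp [RAMExpr.eval, eval_weightExpr hH₂, e24, e26, h1, h2] <;> ring
    · have : (s₂ 27 0 = 0 ∧ e.b = 0) ∨ (s₂ 27 0 ≠ 0 ∧ e.b ≠ 0) := by omega
      rcases this with ⟨h1, h2⟩ | ⟨h1, h2⟩ <;>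
        simp [RAMExpr.eval, eval_weightExpr hH₂, e24, e26, h1, h2] <;> ring

/-- The assignment given by the binary digits of `a` at the labels with respect to `D`. -/
def digitSigns (D : List ℕ) (a v : ℕ) : ℤ :=
  if label D v ≠ 0 ∧ a.testBit (label D v - 1) then -1 else 1

theorem isSign_digitSigns (D : List ℕ) (a : ℕ) : IsSign (digitSigns D a) := by
  intro v
  unfold digitSigns
  split_ifs <;> simp

/-- Only essential variables influence the excess, so the bits of one number code all relevant
assignments. -/
theorem exists_digitSigns {eqs : List FlatEq} (hl : ∀ e ∈ eqs, e.vars.Nodup) {k : ℤ} :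
    (∃ x, IsSign x ∧ k ≤ exc eqs x) ↔ ∃ a < 2 ^ (essentialVars eqs eqs).length,
      k ≤ exc eqs (digitSigns (essentialVars eqs eqs) a) := by
  constructor
  · rintro ⟨x, hx, hk⟩
    let f : Fin (essentialVars eqs eqs).length → Bool := fun i => x (essentialVars eqs eqs)[i] ≠ 1
    refine ⟨Nat.ofBits f, Nat.ofBits_lt_two_pow f, hk.trans_eq ?_⟩
    refine exc_congr hl fun e he h0 v hv => ?_
    have hD : v ∈ essentialVars eqs eqs := mem_essentialVars.2 ⟨e, he, h0, hv⟩
    have hlt := List.idxOf_lt_length_of_mem hD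
    rcases hx v with h | h <;>
      simp [digitSigns, label, hD, Nat.testBit_ofBits_lt _ _ hlt, f, h]
  · rintro ⟨a, -, hk⟩
    exact ⟨_, isSign_digitSigns _ a, hk⟩

/-- Register `25` becomes `1` if some assignment of the essential variables attains the
parameter. -/
def searchProg : RAMProg :=
  setReg 21 (.get 8 (.reg 14)) ;; forTo 22 (.reg 21)
    (digitsProg ;; evalProg ;;
      .cond (.sub (.add (.reg 24) (.const 1)) (.add (.reg 26) (.get 0 (.const 1))))
        (setReg 25 (.const 1)) .skip)

theorem runs_searchProg {B k : ℕ} {eqs : List FlatEq} {s : RAMState} (h : Loaded B k eqs (s 0))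
    (hl : ∀ e ∈ eqs, e.vars.Nodup) (hb : ∀ e ∈ eqs, e.b < 2) (ha : Analyzed k eqs s)
    (hB : 2 ^ (essentialVars eqs eqs).length ≤ B) (h20 : s 20 0 = 0) (h25 : s 25 0 = 0) :
    Runs B searchProg s fun s' =>
      ((∃ x, IsSign x ∧ (k : ℤ) ≤ exc eqs x) → s' 25 0 = 1) ∧
      (¬ (∃ x, IsSign x ∧ (k : ℤ) ≤ exc eqs x) → s' 25 0 = 0) := by
  set D := essentialVars eqs eqs with hD
  have hND : D.length ≤ (firstOccs (eqs.flatMap FlatEq.vars)).length := length_essentialVars_le eqs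
  have h8 : ∀ i ≤ D.length, s 8 i = 2 ^ i := fun i hi => ha.tables.pows i (hi.trans hND)
  rw [exists_digitSigns hl, ← hD]
  refine .seq (.assign ?_)
  refine (Runs.forTo (n := 2 ^ D.length) (fun j s => s 20 0 = 0 ∧
    s 25 0 = if ∃ a < j, (k : ℤ) ≤ exc eqs (digitSigns D a) then 1 else 0) hB rfl ?_
    (fun j s v h => by simpa using h) ⟨by simpa using h20, by simpa using h25⟩ ?_).mono ?_
  · intro s' hf
    simp only [RAMExpr.eval]
    rw [hf 21 rfl]
    simp [RAMExpr.eval, ha.count, ← hD, h8]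
  · rintro j s₁ hj hf h22 ⟨hI20, hI25⟩
    have e14 : s₁ 14 0 = D.length := by rw [hf 14 rfl]; simpa using ha.count
    have e8 : s₁ 8 = s 8 := by rw [hf 8 rfl]; simp
    have e13 : s₁ 13 = label D := by rw [hf 13 rfl]; simpa using ha.labels
    have e0 : s₁ 0 = s 0 := by rw [hf 0 rfl]; simp
    refine .seq ((runs_digitsProg (Nat.lt_two_pow_self.le.trans hB) e14 (e8 ▸ h8) hI20 h22
      hj).mono ?_)
    rintro s₂ hf₂ ⟨hz0, hz⟩
    have hz' (v : ℕ) : s₂ 20 (s₂ 13 v) = if digitSigns D j v = 1 then 0 else 1 := by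
      rw [hf₂ 13 rfl, e13, digitSigns]
      rcases hlab : label D v with _ | d
      · simp [hz0]
      · have := label_le D v
        rw [hz d (by omega)]
        cases hbit : j.testBit d <;> simp [hbit]
    refine .seq ((runs_evalProg (k := k) (by rwa [hf₂ 0 rfl, e0]) hb
      (isSign_digitSigns D j) hz').mono ?_)
    intro s₃ hf₃ hexc
    rw [← hf₂ 25 rfl, ← hf₃ 25 rfl] at hI25
    rw [← hf₃ 20 rfl] at hz0
    have hk : s₃ 0 1 = k := by rw [hf₃ 0 rfl, hf₂ 0 rfl, e0, h.param]
    have hex : (∃ a < j + 1, (k : ℤ) ≤ exc eqs (digitSigns D a)) ↔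
        (∃ a < j, (k : ℤ) ≤ exc eqs (digitSigns D a)) ∨ (k : ℤ) ≤ exc eqs (digitSigns D j) := by
      simp only [Nat.lt_succ_iff_lt_or_eq, or_and_right, exists_or, exists_eq_left]
    refine .cond (fun h0 => .assign ⟨by simpa using hz0, ?_⟩) fun h0 => .skip ⟨hz0, ?_⟩
    all_goals simp only [RAMExpr.eval, hk] at h0
    · rw [if_pos (hex.2 (.inr (by omega)))]
      simp [RAMExpr.eval]
    · have : ¬ (k : ℤ) ≤ exc eqs (digitSigns D j) := by omega
      rw [hI25]
      simp only [hex, this, or_false]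
  · rintro s' - ⟨-, h25'⟩
    exact ⟨fun hy => by rw [h25', if_pos hy], fun hn => by rw [h25', if_neg hn]⟩

/-- The complete decision procedure. -/
def solver (r : ℕ) : RAMProg :=
  analysis ;; .cond (yesExpr r) (setReg 25 (.const 1)) searchProg ;;
    .assign 1 (.const 0) (.const 1) ;; .assign 1 (.const 1) (.reg 25)

theorem runs_solver {B r n k : ℕ} {eqs : List FlatEq} {s : RAMState} (h : Loaded B k eqs (s 0))
    (hl : ∀ e ∈ eqs, e.Valid r n) (hr : 0 < r) (h0 : ∀ b ≠ 0, s b = 0) (hB : 2 ^ (2 * r * k) ≤ B) :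
    Runs B (solver r) s fun s' =>
      ((∃ x, IsSign x ∧ (k : ℤ) ≤ exc eqs x) → s'.HasOutput [1]) ∧
      (¬ (∃ x, IsSign x ∧ (k : ℤ) ≤ exc eqs x) → s'.HasOutput [0]) := by
  have hnd : ∀ e ∈ eqs, e.vars.Nodup := fun e he => (hl e he).nodup
  refine .seq ((runs_analysis h hnd h0).mono fun s₁ hf₁ ha => ?_)
  have h₁ : Loaded B k eqs (s₁ 0) := by rwa [hf₁ 0 rfl]
  have main : Runs B (.cond (yesExpr r) (setReg 25 (.const 1)) searchProg) s₁ fun s' =>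
      ((∃ x, IsSign x ∧ (k : ℤ) ≤ exc eqs x) → s' 25 0 = 1) ∧
      (¬ (∃ x, IsSign x ∧ (k : ℤ) ≤ exc eqs x) → s' 25 0 = 0) := by
    refine .cond (fun hy => .assign ?_) fun hn => ?_
    · rw [Ne, ha.yesExpr_eq_zero_iff h₁.param] at hy
      have := exists_le_exc_of_analysis hl hr hy
      exact ⟨fun _ => by simp [RAMExpr.eval], fun hno => absurd this hno⟩
    · rw [ha.yesExpr_eq_zero_iff h₁.param] at hn
      refine runs_searchProg h₁ hnd (fun e he => (hl e he).b_lt) ha ?_ ?_ ?_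
      · exact (Nat.pow_le_pow_right (by norm_num) hn.2.le).trans hB
      · rw [hf₁ 20 rfl, h0 20 (by decide)]
        rfl
      · rw [hf₁ 25 rfl, h0 25 (by decide)]
        rfl
  refine .seq (main.mono ?_)
  rintro s₂ - ⟨hy, hn⟩
  refine .seq (.assign (.assign ?_))
  refine ⟨fun h => RAMState.hasOutput_iff.2 ⟨?_, ?_⟩, fun h => RAMState.hasOutput_iff.2 ⟨?_, ?_⟩⟩
  · simp [RAMExpr.eval]
  · simp [holds_cons, holds_nil, RAMExpr.eval, hy h]
  · simp [RAMExpr.eval]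
  · simp [holds_cons, holds_nil, RAMExpr.eval, hn h]

/-! ### Output of the reduced system -/

/-- Append the value of the expression to the output; register `17` points to the first free
cell. -/
def emit (e : RAMExpr) : RAMProg :=
  .assign 1 (.reg 17) e ;; setReg 17 (.add (.reg 17) (.const 1))

/-- The output consists of the list, starting at address `4`. -/
def Written (L : List ℕ) (s : RAMState) : Prop := Holds (s 1) 4 L ∧ s 17 0 = 4 + L.length

theorem Written.congr {L : List ℕ} {s s' : RAMState} (h : Written L s) (h1 : s' 1 = s 1)
    (h17 : s' 17 = s 17) : Written L s' := by
  rwa [Written, h1, h17]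

theorem runs_emit {B a : ℕ} {e : RAMExpr} {L : List ℕ} {s : RAMState} (h : Written L s)
    (he : e.eval s = a) : Runs B (emit e) s (Written (L ++ [a])) := by
  refine .seq (.assign (.assign ⟨?_, ?_⟩))
  · simpa [RAMExpr.eval, he] using h.1.snoc h.2 a
  · simp [RAMExpr.eval, h.2, add_assoc]

/-- Output the new names of the variables of the current equation in increasing order. -/
def emitVars : RAMProg :=
  varLoop (.assign 16 (.get 13 (.reg 5)) (.const 1)) ;;
    forTo 9 (.reg 14) (.cond (.get 16 (.add (.reg 9) (.const 1)))
      (emit (.reg 9) ;; .assign 16 (.add (.reg 9) (.const 1)) (.const 0)) .skip)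

/-- Sorting by marking: the labels of the equation are marked, and a sweep in increasing order
outputs the marked positions. The sweep erases the marks, so bank `16` is clean for the next
equation. -/
theorem runs_emitVars {B : ℕ} {eqs : List FlatEq} {e : FlatEq} {D L : List ℕ} {s : RAMState}
    (hB : e.vars.length ≤ B) (hDB : D.length ≤ B) (hH : Holds (s 0) (s 2 0) e.enc)
    (h13 : s 13 = label D) (h14 : s 14 0 = D.length) (hD : ∀ v ∈ e.vars, v ∈ D)
    (h16 : s 16 = 0) (hL : Written L s) :
    Runs B emitVars s fun s' => s' 16 = 0 ∧ Written (L ++ (e.reduce eqs D).vars) s' := by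
  have mark : Runs B (varLoop (.assign 16 (.get 13 (.reg 5)) (.const 1))) s fun s' =>
      s' 16 = fun a => if a ∈ e.vars.map (label D) then 1 else 0 := by
    refine Runs.varLoop (fun vs s => s 16 = fun a => if a ∈ vs.map (label D) then 1 else 0) hB hH
      rfl rfl rfl (fun l s v h => by simpa using h) (fun l s v h => by simpa using h)
      (by rw [h16]; ext; simp) ?_
    intro vs v vs' s' hv hf h5 hI
    refine .assign ?_
    have e13 : s' 13 = label D := by rw [hf 13 rfl, h13]
    ext a
    by_cases ha : a = label D v
    · simp [RAMExpr.eval, h5, e13, ha]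
    · simp only [RAMExpr.eval, h5, e13, RAMState.write_self, hI, Function.update_of_ne ha,
        List.map_append, List.mem_append, List.map_singleton, List.mem_singleton, ha, or_false]
  have hmem (j : ℕ) : j + 1 ∈ e.vars.map (label D) ↔ j ∈ e.vars.map D.idxOf := by
    simp only [List.mem_map]
    refine exists_congr fun v => and_congr_right fun hv => ?_
    simp [label, hD v hv]
  refine .seq (mark.mono fun s₁ hf₁ h16₁ => ?_)
  have hL₁ : Written L s₁ := hL.congr (hf₁ 1 rfl) (hf₁ 17 rfl)
  have := Runs.forTo (B := B) (n := D.length) (i := 9) (e := .reg 14)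
    (P := .cond (.get 16 (.add (.reg 9) (.const 1)))
      (emit (.reg 9) ;; .assign 16 (.add (.reg 9) (.const 1)) (.const 0)) .skip) (s₀ := s₁)
    -- The sweep never visits address `0`, hence the alternative `a = 0`; at the end it is excluded
    -- because all variables of `e` lie in `D`.
    (fun j s => (s 16 = fun a => if a ∈ e.vars.map (label D) ∧ (a = 0 ∨ j < a) then 1 else 0) ∧
      Written (L ++ (List.range j).filter fun i => i ∈ e.vars.map D.idxOf) s) hDB rfl ?_
    ?_ ⟨?_, by simpa using hL₁⟩ ?_
  · refine this.mono ?_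
    rintro s' - ⟨h16', hW⟩
    refine ⟨?_, hW⟩
    rw [h16']
    ext a
    rw [if_neg]
    · rfl
    · rintro ⟨ha, ha'⟩
      obtain ⟨v, hv, rfl⟩ := List.mem_map.1 ha
      have h1 := label_le D v
      have h2 : label D v ≠ 0 := by simp [label, hD v hv]
      omega
  · intro s' hf
    simp only [RAMExpr.eval]
    rw [hf 14 rfl, hf₁ 14 rfl, h14]
  · rintro j s v ⟨h, hW⟩
    exact ⟨by simpa using h, hW.congr (by simp) (by simp)⟩
  · rw [h16₁]
    ext a
    have : a = 0 ∨ 0 < a := by omega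
    simp [this]
  · rintro j s' hj hf h9 ⟨hI16, hW⟩
    have hev : (RAMExpr.get 16 (.add (.reg 9) (.const 1))).eval s' =
        if j ∈ e.vars.map D.idxOf then 1 else 0 := by
      simp only [RAMExpr.eval, h9, hI16, hmem]
      simp
    refine .cond (fun h0 => .seq ?_) fun h0 => .skip ?_
    · have hj' : j ∈ e.vars.map D.idxOf := by
        by_contra hn
        exact h0 (by rw [hev, if_neg hn])
      refine (runs_emit hW (by simpa [RAMExpr.eval] using h9)).mono fun s₂ hf₂ hW₂ => .assign ?_
      refine ⟨?_, ?_⟩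
      · simp only [RAMExpr.eval, RAMState.write_self, hf₂ 16 rfl, hf₂ 9 rfl, h9, hI16]
        ext a
        by_cases ha : a = j + 1
        · subst ha
          simp
        · rw [Function.update_of_ne ha]
          have : (a = 0 ∨ j < a) ↔ (a = 0 ∨ j + 1 < a) := by omega
          simp only [this]
      · refine Written.congr (s := s₂) ?_ (by simp) (by simp)
        rw [List.range_succ, List.filter_append,
          List.filter_cons_of_pos (by rwa [decide_eq_true_eq]),
          List.filter_nil, ← List.append_assoc]
        exact hW₂
    · have hj' : j ∉ e.vars.map D.idxOf := by
        intro hn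
        rw [hev, if_pos hn] at h0
        exact one_ne_zero h0
      refine ⟨?_, ?_⟩
      · rw [hI16]
        ext a
        have : a ∈ e.vars.map (label D) → ((a = 0 ∨ j < a) ↔ (a = 0 ∨ j + 1 < a)) := by
          intro ha
          have : a ≠ j + 1 := by
            rintro rfl
            exact hj' ((hmem j).1 ha)
          omega
        rw [if_congr (and_congr_right this) rfl rfl]
      · rw [List.range_succ, List.filter_append,
          List.filter_cons_of_neg (by rwa [decide_eq_true_eq]), List.filter_nil, List.append_nil]
        exact hW

/-- Output the merged equation for the variables of the current equation. -/
def emitEq : RAMProg :=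
  emit (.get 0 (.reg 2)) ;; emitVars ;;
    emit (.sub (.const 1) (.sub (.const 1) (.sub (.get 12 (.reg 10)) (.get 11 (.reg 10))))) ;;
    emit absExpr

theorem FlatEq.length_reduce_vars {eqs : List FlatEq} {e : FlatEq} {D : List ℕ}
    (he : e.vars.Nodup) (hD : ∀ v ∈ e.vars, v ∈ D) :
    (e.reduce eqs D).vars.length = e.vars.length := by
  rw [← List.toFinset_card_of_nodup e.nodup_reduce_vars, FlatEq.reduce_vars_toFinset hD,
    Finset.card_image_of_injOn (FlatEq.injOn_idxOf hD), FlatEq.varSet,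
    List.toFinset_card_of_nodup he]

theorem runs_emitEq {B : ℕ} {eqs : List FlatEq} {e : FlatEq} {D L : List ℕ} {s : RAMState}
    (hl : ∀ e ∈ eqs, e.vars.Nodup) (he : e ∈ eqs) (ht : Tables eqs s)
    (hB : e.vars.length ≤ B) (hDB : D.length ≤ B) (hH : Holds (s 0) (s 2 0) e.enc)
    (h10 : s 10 0 = keyIn eqs e) (h13 : s 13 = label D) (h14 : s 14 0 = D.length)
    (hD : ∀ v ∈ e.vars, v ∈ D) (h16 : s 16 = 0) (hL : Written L s) :
    Runs B emitEq s fun s' => s' 16 = 0 ∧ Written (L ++ (e.reduce eqs D).enc) s' := by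
  have hlen : (RAMExpr.get 0 (.reg 2)).eval s = (e.reduce eqs D).vars.length := by
    rw [FlatEq.length_reduce_vars (hl e he) hD]
    exact eval_lengthExpr hH
  refine .seq ((runs_emit hL hlen).mono fun s₁ hf₁ hL₁ => ?_)
  refine .seq ((runs_emitVars (eqs := eqs) hB hDB (by rwa [hf₁ 0 rfl, hf₁ 2 rfl])
    (by rwa [hf₁ 13 rfl]) (by rwa [hf₁ 14 rfl]) hD (by rwa [hf₁ 16 rfl]) hL₁).mono ?_)
  rintro s₂ hf₂ ⟨h16₂, hL₂⟩
  have ht₂ : Tables eqs s₂ := ht.congr (by rw [hf₂ 6 rfl, hf₁ 6 rfl]) (by rw [hf₂ 8 rfl, hf₁ 8 rfl])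
    (by rw [hf₂ 11 rfl, hf₁ 11 rfl]) (by rw [hf₂ 12 rfl, hf₁ 12 rfl])
  have h10₂ : s₂ 10 0 = keyIn eqs e := by rw [hf₂ 10 rfl, hf₁ 10 rfl, h10]
  -- Subtracting twice from `1` turns any positive difference into `1` and keeps `0`, which is the
  -- indicator of a negative total.
  have hb : (RAMExpr.sub (.const 1) (.sub (.const 1)
      (.sub (.get 12 (.reg 10)) (.get 11 (.reg 10))))).eval s₂ = (e.reduce eqs D).b := by
    have : _ = coef FlatEq.varSet eqs e.varSet := ht₂.sub_eq hl he
    simp only [RAMExpr.eval, h10₂, FlatEq.reduce]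
    split_ifs <;> omega
  refine .seq ((runs_emit hL₂ hb).mono fun s₃ hf₃ hL₃ => ?_)
  have ht₃ : Tables eqs s₃ := ht₂.congr (hf₃ 6 rfl) (hf₃ 8 rfl) (hf₃ 11 rfl) (hf₃ 12 rfl)
  have hw : absExpr.eval s₃ = (e.reduce eqs D).w :=
    ht₃.eval_absExpr hl he (by rw [hf₃ 10 rfl, h10₂])
  refine (runs_emit hL₃ hw).mono fun s₄ hf₄ hL₄ => ⟨?_, ?_⟩
  · rw [hf₄ 16 rfl, hf₃ 16 rfl, h16₂]
  · simpa [FlatEq.enc] using hL₄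

/-- Output one merged equation for every set of variables of nonzero total signed weight. Bank `15`
records the keys that are done, and register `18` counts the equations of the output. -/
def emitPass : RAMProg :=
  setReg 17 (.const 4) ;; eqLoop (keyProg ;; .cond absExpr
    (.cond (.get 15 (.reg 10)) .skip
      (.assign 15 (.reg 10) (.const 1) ;; setReg 18 (.add (.reg 18) (.const 1)) ;; emitEq)) .skip)

theorem runs_emitPass {B k : ℕ} {eqs : List FlatEq} {s : RAMState} (h : Loaded B k eqs (s 0))
    (hl : ∀ e ∈ eqs, e.vars.Nodup) (ha : Analyzed k eqs s) (h15 : s 15 = 0) (h16 : s 16 = 0)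
    (h18 : s 18 0 = 0) : Runs B emitPass s fun s' => ∃ R,
      IsReduction eqs R (essentialVars eqs eqs) ∧ s' 18 0 = R.length ∧
      Written ((R.map (FlatEq.reduce eqs (essentialVars eqs eqs))).flatMap FlatEq.enc) s' := by
  set D := essentialVars eqs eqs with hDdef
  have hDB : D.length ≤ B :=
    (length_essentialVars_le eqs).trans ((length_firstOccs_le _).trans h.occs_le)
  have hDmem : ∀ e ∈ eqs, netWeight eqs e ≠ 0 → ∀ v ∈ e.vars, v ∈ D :=
    fun e he h0 v hv => mem_essentialVars.2 ⟨e, he, h0, hv⟩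
  refine .seq (.assign ?_)
  -- Bank `15` is described at the keys of all equations of the input, not only those already read,
  -- since the next equation may share its key with an earlier one.
  refine (Runs.eqLoop (B := B) (eqs := eqs) (fun l s => s 16 = 0 ∧ ∃ R : List FlatEq,
    (∀ e ∈ R, e ∈ eqs) ∧ (R.map FlatEq.varSet).Nodup ∧ (∀ e ∈ R, netWeight eqs e ≠ 0) ∧
    (∀ e ∈ l, netWeight eqs e ≠ 0 → ∃ e' ∈ R, e'.varSet = e.varSet) ∧
    (∀ e ∈ eqs, s 15 (keyIn eqs e) ≠ 0 ↔ ∃ e' ∈ R, e'.varSet = e.varSet) ∧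
    s 18 0 = R.length ∧ Written ((R.map (FlatEq.reduce eqs D)).flatMap FlatEq.enc) s)
    h.length_le (by simpa using h.count) (by simpa using h.holds) rfl rfl rfl ?_ ?_ ?_ ?_).mono ?_
  · rintro l s v ⟨hz, R, h1, h2, h3, h4, h5, h6, h7⟩
    exact ⟨hz, R, h1, h2, h3, h4, h5, h6, h7⟩
  · rintro l s v ⟨hz, R, h1, h2, h3, h4, h5, h6, h7⟩
    exact ⟨hz, R, h1, h2, h3, h4, h5, h6, h7⟩
  · exact ⟨h16, [], by simp, by simp, by simp, by simp, by simp [h15], h18,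
      holds_nil, by simp [RAMExpr.eval]⟩
  · rintro l e l' s₁ hel hf hH ⟨hz, R, h1, h2, h3, h4, h5, h6, h7⟩
    have he : e ∈ eqs := by simp [hel]
    have ht₁ : Tables eqs s₁ := ha.tables.congr (hf 6 rfl) (hf 8 rfl) (hf 11 rfl) (hf 12 rfl)
    refine .seq ((ht₁.runs_keyProg (h.vars_length_le he) hH).mono ?_)
    rintro s₂ hf₂ ⟨h10, ht₂, hH₂⟩
    rw [← hf₂ 16 rfl] at hz
    rw [← hf₂ 15 rfl] at h5
    rw [← hf₂ 18 rfl] at h6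
    replace h7 := h7.congr (hf₂ 1 rfl) (hf₂ 17 rfl)
    have hcover (hex : netWeight eqs e ≠ 0 → ∃ e' ∈ R, e'.varSet = e.varSet) :
        ∀ e₁ ∈ l ++ [e], netWeight eqs e₁ ≠ 0 → ∃ e' ∈ R, e'.varSet = e₁.varSet := by
      intro e₁ he₁
      rcases List.mem_append.1 he₁ with he₁ | he₁
      · exact h4 e₁ he₁
      · rw [List.mem_singleton.1 he₁]
        exact hex
    refine .cond (fun h0 => .cond (fun hd => .skip ?_) fun hd => ?_) fun h0 => .skip ?_
    all_goals rw [ht₂.eval_absExpr hl he h10] at h0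
    · simp only [RAMExpr.eval, h10] at hd
      exact ⟨hz, R, h1, h2, h3, hcover fun _ => (h5 e he).1 hd, h5, h6, h7⟩
    · have hne : netWeight eqs e ≠ 0 := Int.natAbs_ne_zero.1 h0
      simp only [RAMExpr.eval, h10] at hd
      have hnew : ¬ ∃ e' ∈ R, e'.varSet = e.varSet := fun hex => (h5 e he).2 hex hd
      refine .seq (.assign (.seq (.assign ?_)))
      refine Runs.mono (Q := fun s' => s' 16 = 0 ∧ Written
        ((R.map (FlatEq.reduce eqs D)).flatMap FlatEq.enc ++ (e.reduce eqs D).enc) s')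
        (runs_emitEq hl he (ht₂.congr rfl rfl rfl rfl) (h.vars_length_le he) hDB hH₂ h10
          ((hf₂ 13 rfl).trans ((hf 13 rfl).trans ha.labels))
          ((congrFun (hf₂ 14 rfl) 0).trans ((congrFun (hf 14 rfl) 0).trans ha.count))
          (hDmem e he hne) hz h7) ?_
      rintro s₃ hf₃ ⟨hz₃, hW₃⟩
      refine ⟨hz₃, R ++ [e], ?_, ?_, ?_, ?_, ?_, ?_, ?_⟩
      · simpa [or_imp, forall_and] using ⟨h1, he⟩
      · rw [List.map_append, List.nodup_append]
        refine ⟨h2, by simp, ?_⟩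
        rintro T hT T' hT' rfl
        obtain ⟨e', he', rfl⟩ := List.mem_map.1 hT
        exact hnew ⟨e', he', by simpa using hT'⟩
      · simp only [List.mem_append, List.mem_singleton]
        rintro e' (he' | rfl)
        · exact h3 e' he'
        · exact hne
      · intro e₁ he₁ h01
        rcases List.mem_append.1 he₁ with he₁ | he₁
        · obtain ⟨e', he', heq⟩ := h4 e₁ he₁ h01
          exact ⟨e', by simp [he'], heq⟩
        · exact ⟨e, by simp, by rw [List.mem_singleton.1 he₁]⟩
      · intro e₁ he₁
        rw [hf₃ 15 rfl]
        have hk := keyIn_eq_iff hl he₁ he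
        have hor : (∃ e' ∈ R ++ [e], e'.varSet = e₁.varSet) ↔
            (∃ e' ∈ R, e'.varSet = e₁.varSet) ∨ e₁.varSet = e.varSet := by
          simp only [List.mem_append, List.mem_singleton, or_and_right, exists_or, exists_eq_left]
          rw [eq_comm (a := e.varSet)]
        rw [hor, ← h5 e₁ he₁, ← hk]
        by_cases heq : keyIn eqs e₁ = keyIn eqs e
        · simp [RAMExpr.eval, h10, heq]
        · simp [RAMExpr.eval, h10, heq]
      · rw [hf₃ 18 rfl]
        simp [RAMExpr.eval, h6]
      · simpa using hW₃
    · exact ⟨hz, R, h1, h2, h3, hcover fun hne => absurd h0 (Int.natAbs_ne_zero.2 hne), h5, h6, h7⟩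
  · rintro s' - ⟨-, R, h1, h2, h3, h4, -, h6, h7⟩
    exact ⟨R, ⟨h1, h2, h3, h4, hDmem⟩, h6, h7⟩

/-- The complete kernelization. -/
def kernelizer (r : ℕ) : RAMProg :=
  analysis ;; .cond (yesExpr r) (.assign 1 (.const 0) (.const 3))
    (emitPass ;; .assign 1 (.const 0) (.sub (.reg 17) (.const 1)) ;;
      .assign 1 (.const 1) (.get 0 (.const 1)) ;; .assign 1 (.const 2) (.reg 14) ;;
      .assign 1 (.const 3) (.reg 18))

theorem runs_kernelizer {B r n k : ℕ} {eqs : List FlatEq} {s : RAMState}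
    (h : Loaded B k eqs (s 0)) (hl : ∀ e ∈ eqs, e.Valid r n) (hr : 0 < r)
    (h0 : ∀ b ≠ 0, s b = 0) :
    Runs B (kernelizer r) s fun s' =>
      ((∃ x, IsSign x ∧ (k : ℤ) ≤ exc eqs x) ∧ s'.HasOutput [0, 0, 0]) ∨
      ∃ R D, IsReduction eqs R D ∧ D.length < 2 * r * k ∧
        (∀ e ∈ eqs, (netWeight eqs e).natAbs < k) ∧
        s'.HasOutput (k :: D.length :: R.length ::
          (R.map (FlatEq.reduce eqs D)).flatMap FlatEq.enc) := by
  have hnd : ∀ e ∈ eqs, e.vars.Nodup := fun e he => (hl e he).nodup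
  refine .seq ((runs_analysis h hnd h0).mono fun s₁ hf₁ ha => ?_)
  have h₁ : Loaded B k eqs (s₁ 0) := by rwa [hf₁ 0 rfl]
  -- A positive answer is output as the empty system with parameter `0`. The output bank is still
  -- zero, so writing the length `3` is enough.
  refine .cond (fun hy => .assign (.inl ⟨?_, ?_⟩)) fun hn => ?_
  · rw [Ne, ha.yesExpr_eq_zero_iff h₁.param] at hy
    exact exists_le_exc_of_analysis hl hr hy
  · have : s₁ 1 = 0 := by rw [hf₁ 1 rfl, h0 1 (by decide)]
    rw [RAMState.hasOutput_iff]
    simp [holds_cons, holds_nil, RAMExpr.eval, this]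
  · rw [ha.yesExpr_eq_zero_iff h₁.param] at hn
    refine .seq ((runs_emitPass h₁ hnd ha (by rw [hf₁ 15 rfl, h0 15 (by decide)])
      (by rw [hf₁ 16 rfl, h0 16 (by decide)]) (by rw [hf₁ 18 rfl, h0 18 (by decide)]; rfl)).mono ?_)
    rintro s₂ hf₂ ⟨R, hR, h18, hW⟩
    refine .seq (.assign (.seq (.assign (.seq (.assign (.assign
      (.inr ⟨R, essentialVars eqs eqs, hR, hn.2, hn.1, ?_⟩)))))))
    have h14 : s₂ 14 0 = (essentialVars eqs eqs).length := by rw [hf₂ 14 rfl, ha.count]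
    have hk : s₂ 0 1 = k := by rw [hf₂ 0 rfl, h₁.param]
    rw [RAMState.hasOutput_iff]
    simp only [holds_cons]
    refine ⟨?_, ?_, ?_, ?_, ?_⟩
    · simp [RAMExpr.eval, hW.2]
      omega
    · simp [RAMExpr.eval, hk]
    · simp [RAMExpr.eval, h14]
    · simp [RAMExpr.eval, h18]
    · simp only [RAMState.write_self]
      exact (((hW.1.update_lt (by simp [RAMExpr.eval]) _).update_lt (by simp [RAMExpr.eval])
        _).update_lt (by simp [RAMExpr.eval]) _).update_lt (by simp [RAMExpr.eval]) _

/-! ### Kernel and running time -/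

theorem length_le_length_flatMap_enc (l : List FlatEq) :
    l.length ≤ (l.flatMap FlatEq.enc).length ∧
      (l.flatMap FlatEq.vars).length ≤ (l.flatMap FlatEq.enc).length := by
  induction l with
  | nil => simp
  | cons e l ih =>
    simp only [List.flatMap_cons, List.length_append, List.length_cons, FlatEq.length_enc]
    omega

theorem RLinSystem.loaded_init {r B : ℕ} (I : RLinSystem r) (k : ℕ)
    (hB : (I.flat.flatMap FlatEq.enc).length ≤ B) :
    Loaded B k I.flat (RAMState.init (k :: I.encode) 0) := by
  have h := RAMState.holds_init (k :: I.encode)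
  rw [I.encode_eq] at h ⊢
  simp only [holds_cons] at h
  obtain ⟨hlen, henc⟩ := length_le_length_flatMap_enc I.flat
  exact ⟨h.2.1, h.2.2.2.1, h.2.2.2.2, hlen.trans hB, henc.trans hB⟩

theorem RAMState.init_of_ne_zero (l : List ℕ) (b : ℕ) (hb : b ≠ 0) : RAMState.init l b = 0 := by
  ext a
  simp [RAMState.init, hb]

theorem length_le_bitLength (l : List ℕ) : l.length ≤ bitLength l := by
  induction l with
  | nil => simp
  | cons a l ih =>
    simp only [bitLength, List.map_cons, List.sum_cons, List.length_cons] at ih ⊢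
    omega

theorem bitLength_le {l : List ℕ} {M : ℕ} (h : ∀ a ∈ l, a ≤ M) :
    bitLength l ≤ l.length * (M + 1) := by
  rw [bitLength, ← List.length_map (f := fun a => Nat.size a + 1), ← smul_eq_mul]
  refine List.sum_le_card_nsmul _ _ fun b hb => ?_
  obtain ⟨a, ha, rfl⟩ := List.mem_map.1 hb
  have := Nat.size_le.2 (Nat.lt_two_pow_self (n := a))
  have := h a ha
  omega

theorem length_flatMap_enc_le {r : ℕ} {l : List FlatEq} (h : ∀ e ∈ l, e.vars.length ≤ r) :
    (l.flatMap FlatEq.enc).length ≤ l.length * (r + 3) := by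
  rw [List.length_flatMap, ← List.length_map (f := fun e : FlatEq => e.enc.length), ← smul_eq_mul]
  refine List.sum_le_card_nsmul _ _ fun b hb => ?_
  obtain ⟨e, he, rfl⟩ := List.mem_map.1 hb
  rw [FlatEq.length_enc]
  have := h e he
  omega

/-- Bound for the bit length of the kernel. -/
def kernelSize (r k : ℕ) : ℕ :=
  (2 ^ (2 * r * k) * (r + 3) + 2) * (2 * r * k + 2 ^ (2 * r * k) + r + 1 + k + 1)

theorem RLinSystem.bitLength_encode_le {r k : ℕ} (I : RLinSystem r) (hn : I.n ≤ 2 * r * k)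
    (hm : I.flat.length ≤ 2 ^ (2 * r * k)) (hw : ∀ e ∈ I.flat, e.w ≤ k) :
    bitLength I.encode ≤ kernelSize r k := by
  rw [I.encode_eq]
  refine (bitLength_le (M := 2 * r * k + 2 ^ (2 * r * k) + r + 1 + k) ?_).trans ?_
  · simp only [List.mem_cons, List.mem_flatMap]
    rintro a (rfl | rfl | ⟨e, he, ha⟩)
    · omega
    · omega
    · have hv := I.valid_flat e he
      have := hw e he
      have := hv.length_le
      have := hv.b_lt
      simp only [FlatEq.enc, List.mem_append, List.mem_cons, List.not_mem_nil, or_false] at ha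
      rcases ha with (rfl | ha) | rfl | rfl
      · omega
      · have := hv.lt a ha
        omega
      · omega
      · omega
  · rw [kernelSize]
    gcongr
    simp only [List.length_cons]
    have := length_flatMap_enc_le fun e he => (I.valid_flat e he).length_le
    have := Nat.mul_le_mul_right (r + 3) hm
    omega

theorem maxRLinAA_hasKernelWith {r : ℕ} (hr : 0 < r) :
    (maxRLinAA r).HasKernelWith (fun I : RLinSystem r => I.n) fun k => 2 * r * k := by
  obtain ⟨C, D, hCD⟩ := (kernelizer r).exists_timeBound_le
  refine ⟨kernelizer r, Polynomial.C C * (Polynomial.X + 1) ^ D, fun k => k,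
    kernelSize r, fun (I : RLinSystem r) k => ?_⟩
  have hB : (I.flat.flatMap FlatEq.enc).length ≤ bitLength (k :: I.encode) := by
    refine le_trans ?_ (length_le_bitLength _)
    rw [I.encode_eq]
    simp only [List.length_cons]
    omega
  have hp : (Polynomial.C C * (Polynomial.X + 1) ^ D).eval (bitLength (k :: I.encode)) =
      C * (bitLength (k :: I.encode) + 1) ^ D := by
    simp
  obtain ⟨t, s, ht, hex, hout⟩ := runs_kernelizer (I.loaded_init k hB) I.valid_flat hr
    (RAMState.init_of_ne_zero _)
  have htime := (ht.trans (hCD _)).trans_eq hp.symm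
  rcases hout with ⟨hyes, hout⟩ | ⟨R, D', hR, hD, hw, hout⟩
  · refine ⟨(⟨0, []⟩ : RLinSystem r), 0, ⟨t, s, htime, hex, hout⟩, ?_, Nat.zero_le _, ?_,
      Nat.zero_le _⟩
    · rw [maxRLinAA_yes_iff, maxRLinAA_yes_iff]
      exact iff_of_true hyes ⟨fun _ => 1, fun _ => .inl rfl, by simp [RLinSystem.flat, exc]⟩
    · exact RLinSystem.bitLength_encode_le (⟨0, []⟩ : RLinSystem r) (Nat.zero_le _)
        (by simp [RLinSystem.flat]) (by simp [RLinSystem.flat])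
  · have hvalid : ∀ e ∈ R.map (FlatEq.reduce I.flat D'), e.Valid r D'.length := by
      intro e' he'
      obtain ⟨e, he, rfl⟩ := List.mem_map.1 he'
      exact FlatEq.valid_reduce (I.valid_flat e (hR.subset e he))
        (hR.mem e (hR.subset e he) (hR.ne_zero e he)) (hR.ne_zero e he)
    -- The kernel keeps the parameter `k` and has the essential variables, fewer than `2 * r * k`,
    -- as its variables.
    obtain ⟨es, hes⟩ := exists_map_flat hvalid
    let I' : RLinSystem r := ⟨D'.length, es⟩
    have hflat : I'.flat = R.map (FlatEq.reduce I.flat D') := hes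
    have henc : I'.encode = D'.length :: R.length ::
        (R.map (FlatEq.reduce I.flat D')).flatMap FlatEq.enc := by
      rw [I'.encode_eq, hflat, List.length_map]
    refine ⟨I', k, ⟨t, s, htime, hex, ?_⟩, ?_, le_rfl, ?_, hD.le⟩
    · change s.HasOutput (k :: I'.encode)
      rwa [henc]
    · rw [maxRLinAA_yes_iff, maxRLinAA_yes_iff, hflat,
        hR.exists_le_exc_iff fun e he => (I.valid_flat e he).nodup]
    · refine I'.bitLength_encode_le hD.le ?_ ?_
      · rw [hflat, List.length_map]
        exact hR.length_le.trans (Nat.pow_le_pow_right (by norm_num) hD.le)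
      · rw [hflat]
        intro e' he'
        obtain ⟨e, he, rfl⟩ := List.mem_map.1 he'
        exact (hw e (hR.subset e he)).le

/-- Turns a polynomial in `m` and `2 ^ t` into a sum: the larger of `m` and `2 ^ t` absorbs the
other, and each constant `y` is at most a `y`-th power of a base that is at least `2`. -/
theorem mul_pow_le_two_pow_add_pow (C D c t m : ℕ) :
    C * (m * c + 2 ^ t + 1) ^ D ≤ 2 ^ (C + D * (c + 2 + t)) + m ^ (C + D * (c + 3)) := by
  have h1 : 1 ≤ 2 ^ t := Nat.one_le_two_pow
  have hle (a y : ℕ) (ha : 2 ≤ a) : y ≤ a ^ y :=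
    Nat.lt_two_pow_self.le.trans (Nat.pow_le_pow_left ha y)
  rcases le_or_gt m (2 ^ t) with hm | hm
  · refine le_trans ?_ (Nat.le_add_right _ _)
    calc C * (m * c + 2 ^ t + 1) ^ D ≤ 2 ^ C * (2 ^ (c + 2) * 2 ^ t) ^ D := by
          gcongr
          · exact hle 2 C le_rfl
          · calc m * c + 2 ^ t + 1 ≤ 2 ^ t * c + 2 ^ t + 2 ^ t := by gcongr
              _ = (c + 2) * 2 ^ t := by ring
              _ ≤ _ := by
                gcongr
                exact hle 2 _ le_rfl
      _ = _ := by rw [← pow_add, ← pow_mul, ← pow_add, mul_comm D]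
  · refine le_trans ?_ (Nat.le_add_left _ _)
    have h2 : 2 ≤ m := by omega
    calc C * (m * c + 2 ^ t + 1) ^ D ≤ m ^ C * (m ^ (c + 2) * m) ^ D := by
          gcongr
          · exact hle m C h2
          · calc m * c + 2 ^ t + 1 ≤ m * c + m + m := by omega
              _ = (c + 2) * m := by ring
              _ ≤ _ := by
                gcongr
                exact hle m _ h2
      _ = _ := by ring

theorem maxRLinAA_solvableInTime {r : ℕ} (hr : 0 < r) : ∃ a b d : ℕ,
    (maxRLinAA r).SolvableInTime fun (I : RLinSystem r) k => 2 ^ (a * k + b) + I.m ^ d := by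
  obtain ⟨C, D, hCD⟩ := (solver r).exists_timeBound_le
  refine ⟨D * (2 * r), C + D * (r + 3 + 2), C + D * (r + 3 + 3), solver r,
    fun (I : RLinSystem r) k => ?_⟩
  have hB := length_flatMap_enc_le fun e he => (I.valid_flat e he).length_le
  rw [I.length_flat] at hB
  -- The iteration bound is `m * (r + 3) + 2 ^ (2 * r * k)`: encoded equations have at most `r + 3`
  -- numbers each, and the search visits at most `2 ^ (2 * r * k)` assignments.
  obtain ⟨t, s, ht, hex, hyes, hno⟩ := runs_solver
    (I.loaded_init k (hB.trans (Nat.le_add_right _ (2 ^ (2 * r * k))))) I.valid_flat hr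
    (RAMState.init_of_ne_zero _) (Nat.le_add_left _ _)
  have htime : t ≤ 2 ^ (D * (2 * r) * k + (C + D * (r + 3 + 2))) + I.m ^ (C + D * (r + 3 + 3)) := by
    refine (ht.trans (hCD _)).trans ((mul_pow_le_two_pow_add_pow _ _ _ _ _).trans_eq ?_)
    congr 2
    ring
  rw [maxRLinAA_yes_iff]
  exact ⟨fun h => ⟨t, s, htime, hex, hyes h⟩, fun h => ⟨t, s, htime, hex, hno h⟩⟩

theorem isBigO_linear_mul_log (a b : ℕ) :
    (fun k : ℕ => ((a * k + b : ℕ) : ℝ)) =O[Filter.atTop] fun k : ℕ => (k : ℝ) * Real.log k := by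
  refine Asymptotics.IsBigO.of_bound (a + b : ℝ) ?_
  -- From `k = 3 > e` on the logarithm is at least `1`, so `k * log k` dominates both `k` and `1`.
  filter_upwards [Filter.eventually_ge_atTop 3] with k hk
  have hk' : (3 : ℝ) ≤ k := by exact_mod_cast hk
  have hlog : 1 ≤ Real.log k := by
    rw [Real.le_log_iff_exp_le (by linarith)]
    linarith [Real.exp_one_lt_three]
  have hkl : (k : ℝ) ≤ k * Real.log k := le_mul_of_one_le_right (by linarith) hlog
  rw [Real.norm_of_nonneg (by positivity), Real.norm_of_nonneg (by linarith)]
  push_cast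
  have ha : (a : ℝ) * k ≤ a * (k * Real.log k) := by gcongr
  have hb : (b : ℝ) * 1 ≤ b * (k * Real.log k) := by
    gcongr
    linarith
  linarith

theorem mainTheorem5 (r : ℕ) (hr : 2 ≤ r) :
    (∃ h : ℕ → ℕ,
      ((fun k : ℕ => (h k : ℝ)) =O[Filter.atTop] fun k : ℕ => (k : ℝ) * Real.log k) ∧
      (maxRLinAA r).HasKernelWith (fun I : RLinSystem r => I.n) h) ∧
    (∃ (h : ℕ → ℕ) (d : ℕ),
      ((fun k : ℕ => (h k : ℝ)) =O[Filter.atTop] fun k : ℕ => (k : ℝ) * Real.log k) ∧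
      (maxRLinAA r).SolvableInTime (fun (I : RLinSystem r) k => 2 ^ h k + I.m ^ d)) := by
  have hr0 : 0 < r := by omega
  obtain ⟨a, b, d, hsolve⟩ := maxRLinAA_solvableInTime hr0
  exact ⟨⟨fun k => 2 * r * k, isBigO_linear_mul_log (2 * r) 0, maxRLinAA_hasKernelWith hr0⟩,
    fun k => a * k + b, d, isBigO_linear_mul_log a b, hsolve⟩
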